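/- Fix $T>0$, $d\in\mathbb N$ and an integer $u\ge 1$. Let $Y$ be a random label with values $\pm1$, with $p_\pm=\mathbb P(Y=\pm1)>0$. Let $Z=(Z_t)_{t\in[0,T]}$ be a process with values in $[0,1]^d$, independent of $Y$, such that $(t,\omega)\mapsto Z_t(\omega)$ is measurable for $\mathcal B([0,T])\otimes\sigma(Z_s:s\in[0,T])$ (for instance, $Z$ has right-continuous paths). Let $X=(X_t)_{t\in[0,T]}$ be a process whose paths are counting paths (right-continuous, piecewise constant, starting at $0$, with jumps of size $1$) and which, conditionally on $Y=\pm1$, is a Cox process with intensity $(\lambda_\pm(t,Z_t))_{t\in[0,T]}$; that is, conditionally on $Y$ and $Z$, $X$ is a Poisson process with intensity $\lambda_+(t,Z_t)$ if $Y=1$ and $\lambda_-(t,Z_t)$ if $Y=-1$, where $\lambda_\pm:[0,T]\times[0,1]^d\to\mathbb R$ are measurable. For a counting path $x$ let $\tau(x)=\inf\{t\in[0,T]:x_t=u\}$ with $\inf\emptyset=\infty$, write $\tau=\tau(X)$, and let $X^\tau_t=X_{t\wedge\tau}$, $Z^\tau_t=Z_{t\wedge\tau}$. Let $\phi(t)=\log_2(1+e^t)$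 and $A(f)=\mathbb E\,\phi(-Yf(X^\tau,Z^\tau))$, and let $A(f^\star)=\inf_f A(f)$ be the minimal risk over all measurable real-valued functions $f$ of the pair of stopped paths. Given measurable functions $\varphi_j:[0,T]\times[0,1]^d\to\mathbb R$, $j\ge1$, put $$\Phi_j(x,z)=\int_0^{T\wedge\tau(x)}\varphi_j(s,z_s)\,ds,\qquad \Psi_j(x,z)=\int_0^{T\wedge\tau(x)}\varphi_j(s,z_s)\,dx_s,$$ and, for every positive integer $B$, $$\mathcal F_B=\Big\{\sum_{j=1}^B[a_j\Phi_j+b_j\Psi_j]+c:\ \max\Big(\sum_{j=1}^B|a_j|,\ \sum_{j=1}^B|b_j|,\ |c|\Big)\le B\Big\}.$$ Assume that there are a finite measure $\mu$ on $[0,1]^d$ and constants $D>0$, $\varepsilon>0$ such that, for every $t\in[0,T]$, the law of $Z_t$ has a density with respect to $\mu$ bounded by $D$, and such that $\lambda_+$ and $\lambda_-$ take their values in $[\varepsilon,D]$. Assume that $(\varphi_j)_{j\ge1}$ is an orthonormal basis of $L^2(ds\otimes\mu)$, with $ds$ the Lebesgue measure on $[0,T]$, and that $\lambda_--\lambda_+$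 and $\ln\frac{\lambda_+}{\lambda_-}$ both belong to $$\mathcal W(\beta,M)=\Big\{f=\sum_{j\ge1}a_j\varphi_j:\ \sum_{j\ge1}j^{2\beta}a_j^2\le M^2\Big\}$$ for some integer $\beta\ge1$ and some $M>0$. Write $\lambda_--\lambda_+=\sum_j a^\star_j\varphi_j$ and $\ln\frac{\lambda_+}{\lambda_-}=\sum_j b^\star_j\varphi_j$, and let $\|a\|_2=(\sum_j a_j^2)^{1/2}$. Then, for every integer $B\ge\max\big(M^2,\big|\ln\frac{p_+}{p_-}\big|\big)$, $$\inf_{f\in\mathcal F_B}\big(A(f)-A(f^\star)\big)\le\frac{2D\sqrt{T\mu([0,1]^d)\,M\|a^\star\|_2}}{B^{\beta/2}}+\frac{2D\big(1+D\sqrt{T\mu([0,1]^d)}\big)\sqrt{M\|b^\star\|_2}}{B^{\beta/2}}.$$ -/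

import Mathlib

open MeasureTheory ProbabilityTheory Filter Topology

noncomputable section

namespace CoxClassification

/-- The cube `[0,1]^d`. -/
abbrev Cube (d : ℕ) : Type := Fin d → unitInterval

/-- The time interval `[0,T]`. -/
abbrev Time (T : ℝ) : Type := Set.Icc (0 : ℝ) T

/-- Lebesgue measure on `[0,T]`. -/
def lebesgue (T : ℝ) : Measure (Time T) :=
  Measure.comap Subtype.val (volume : Measure ℝ)

/-- Counting paths on `[0,T]`: right-continuous, nondecreasing, integer-valued, starting at `0`,
with jumps of size `1` (the value at `t` exceeds the left limit at `t`, which is the largest value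
taken before `t`, by at most `1`). -/
structure IsCountingPath {T : ℝ} (x : Time T → ℕ) : Prop where
  zero : ∀ t : Time T, (t : ℝ) = 0 → x t = 0
  mono : Monotone x
  rightCont : ∀ t : Time T, ContinuousWithinAt x (Set.Ici t) t
  jump : ∀ t : Time T, 0 < (t : ℝ) → ∃ s : Time T, s < t ∧ x t ≤ x s + 1

/-- `T ∧ inf S` for `S ⊆ [0,T]`, where `inf ∅ = ∞`. -/
def firstTime {T : ℝ} [hT : Fact (0 < T)] (S : Set (Time T)) : Time T :=
  ⟨sInf (insert T (Subtype.val '' S)), by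
    constructor
    · refine le_csInf ⟨T, Set.mem_insert _ _⟩ ?_
      rintro b (rfl | ⟨s, -, rfl⟩)
      · exact hT.out.le
      · exact s.2.1
    · refine csInf_le ⟨0, ?_⟩ (Set.mem_insert _ _)
      rintro b (rfl | ⟨s, -, rfl⟩)
      · exact hT.out.le
      · exact s.2.1⟩

/-- `T ∧ inf {t : x_t = k}`: for a counting path, the time of the `k`-th jump, truncated at `T`. -/
def jumpTime {T : ℝ} [Fact (0 < T)] (k : ℕ) (x : Time T → ℕ) : Time T :=
  firstTime {t | x t = k}

/-- The pair `(x^τ, z^τ)` of paths stopped at `τ = inf {t : x_t = u}`. -/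
def stopped {T : ℝ} [Fact (0 < T)] {d : ℕ} (u : ℕ) (x : Time T → ℕ) (z : Time T → Cube d) :
    (Time T → ℕ) × (Time T → Cube d) :=
  (fun t => x (min t (jumpTime u x)), fun t => z (min t (jumpTime u x)))

/-- `∫_0^{T ∧ τ(x)} g(s, z_s) ds`. -/
def timeIntegral {T : ℝ} [Fact (0 < T)] {d : ℕ} (u : ℕ) (g : Time T × Cube d → ℝ)
    (p : (Time T → ℕ) × (Time T → Cube d)) : ℝ :=
  ∫ s in Set.Iic (jumpTime u p.1), g (s, p.2 s) ∂(lebesgue T)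

/-- `∫_0^{T ∧ τ(x)} g(s, z_s) dx_s`: the sum of `g(s, z_s)` over the jump times `s ≤ T ∧ τ(x)` of
the counting path `x`; these are the first `x_{T ∧ τ(x)}` jump times. -/
def jumpIntegral {T : ℝ} [Fact (0 < T)] {d : ℕ} (u : ℕ) (g : Time T × Cube d → ℝ)
    (p : (Time T → ℕ) × (Time T → Cube d)) : ℝ :=
  ∑ k ∈ Finset.Icc 1 (p.1 (jumpTime u p.1)), g (jumpTime k p.1, p.2 (jumpTime k p.1))

/-- The class `F_B`. The dictionary `(φ_j)_{j ≥ 1}` is indexed from `0`: `φ j` is its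
`(j+1)`-st element. -/
def classF {T : ℝ} [Fact (0 < T)] {d : ℕ} (u : ℕ) (φ : ℕ → Time T × Cube d → ℝ) (B : ℕ) :
    Set ((Time T → ℕ) × (Time T → Cube d) → ℝ) :=
  {f | ∃ (a b : ℕ → ℝ) (c : ℝ),
      max (max (∑ j ∈ Finset.range B, |a j|) (∑ j ∈ Finset.range B, |b j|)) |c| ≤ (B : ℝ) ∧
      f = fun p => ∑ j ∈ Finset.range B,
        (a j * timeIntegral u (φ j) p + b j * jumpIntegral u (φ j) p) + c}

/-- The logit loss `log₂ (1 + e^t)`. -/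
def logitLoss (t : ℝ) : ℝ := Real.logb 2 (1 + Real.exp t)

variable {Ω : Type*} [MeasurableSpace Ω]

/-- The risk `A(f) = E φ(-Y f(X^τ, Z^τ))`, for the logit loss `φ`; it takes values in `[0,∞]`. -/
def risk {T : ℝ} [Fact (0 < T)] {d : ℕ} (P : Measure Ω) (u : ℕ) (X : Time T → Ω → ℕ)
    (Z : Time T → Ω → Cube d) (Y : Ω → ℝ) (f : (Time T → ℕ) × (Time T → Cube d) → ℝ) : ENNReal :=
  ∫⁻ ω, ENNReal.ofReal
    (logitLoss (-(Y ω) * f (stopped u (fun t => X t ω) (fun t => Z t ω)))) ∂P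

/-- The minimal risk `A(f⋆)` over all measurable functions `f` of the pair of stopped paths
(spaces of paths carry the σ-algebra generated by the coordinates). -/
def optimalRisk {T : ℝ} [Fact (0 < T)] {d : ℕ} (P : Measure Ω) (u : ℕ) (X : Time T → Ω → ℕ)
    (Z : Time T → Ω → Cube d) (Y : Ω → ℝ) : ENNReal :=
  ⨅ (f : (Time T → ℕ) × (Time T → Cube d) → ℝ) (_ : Measurable f), risk P u X Z Y f

/-- The σ-algebra `σ(Z_t : t ∈ [0,T])` on `Ω`. -/
@[reducible] def sigmaZ {T : ℝ} {d : ℕ} (Z : Time T → Ω → Cube d) : MeasurableSpace Ω :=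
  MeasurableSpace.comap (fun ω t => Z t ω) inferInstance

/-- The σ-algebra `σ(Y, Z_t : t ∈ [0,T])` on `Ω`. -/
@[reducible] def sigmaYZ {T : ℝ} {d : ℕ} (Y : Ω → ℝ) (Z : Time T → Ω → Cube d) : MeasurableSpace Ω :=
  MeasurableSpace.comap (fun ω => (Y ω, fun t => Z t ω)) inferInstance

/-- The intensity `λ_y`: `λ_+` if `y = 1`, and `λ_-` otherwise. -/
def intensity {T : ℝ} {d : ℕ} (lamP lamM : Time T × Cube d → ℝ) (y : ℝ) :
    Time T × Cube d → ℝ :=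
  if y = 1 then lamP else lamM

/-- The model: `Y` is a label with values `±1`, both of positive probability; `Z` is a covariable
process with values in `[0,1]^d`, independent of `Y`; conditionally on `Y = ±1`, the counting
process `X` is a Cox process with intensity `λ_±(t, Z_t)`, that is, conditionally on `Y` and `Z`
it is a Poisson process with that intensity: its increments over successive intervals are
independent Poisson variables whose means are the integrals of the intensity. -/
structure IsCoxMixture {T : ℝ} {d : ℕ} (P : Measure Ω) (X : Time T → Ω → ℕ)
    (Z : Time T → Ω → Cube d) (Y : Ω → ℝ) (lamP lamM : Time T × Cube d → ℝ) : Prop where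
  measurable_X : ∀ t, Measurable (X t)
  measurable_Z : ∀ t, Measurable (Z t)
  /-- `(t, ω) ↦ Z_t(ω)` is measurable for `Borel([0,T]) ⊗ σ(Z)`. -/
  jointly_measurable_Z :
    Measurable[MeasurableSpace.prod inferInstance (sigmaZ Z)] (fun q : Time T × Ω => Z q.1 q.2)
  measurable_Y : Measurable Y
  label : ∀ ω, Y ω = 1 ∨ Y ω = -1
  label_pos : 0 < P {ω | Y ω = 1}
  label_neg : 0 < P {ω | Y ω = -1}
  indep : IndepFun (fun ω t => Z t ω) Y P
  counting : ∀ ω, IsCountingPath (fun t => X t ω)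
  cox : ∀ (n : ℕ) (t : Fin (n + 1) → Time T), Monotone t → ∀ k : Fin n → ℕ,
    P⟦{ω | ∀ i : Fin n, X (t i.succ) ω = X (t i.castSucc) ω + k i} | sigmaYZ Y Z⟧
      =ᵐ[P] fun ω => ∏ i : Fin n,
        (Real.exp (-(∫ s in Set.Ioc (t i.castSucc) (t i.succ),
              intensity lamP lamM (Y ω) (s, Z s ω) ∂(lebesgue T)))
          * (∫ s in Set.Ioc (t i.castSucc) (t i.succ),
              intensity lamP lamM (Y ω) (s, Z s ω) ∂(lebesgue T)) ^ (k i) / (Nat.factorial (k i) : ℝ))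

/-- The measure `ds ⊗ μ` on `[0,T] × [0,1]^d`. -/
def timeProd (T : ℝ) {d : ℕ} (μ : Measure (Cube d)) : Measure (Time T × Cube d) :=
  (lebesgue T).prod μ

/-- The functions `φ j`, `j = 0, 1, …`, form an orthonormal (Hilbert) basis of `L²(ν)`. -/
def IsOrthonormalBasis {E : Type*} [MeasurableSpace E] (ν : Measure E) (φ : ℕ → E → ℝ) : Prop :=
  ∃ e : HilbertBasis ℕ ℝ (Lp ℝ 2 ν), ∀ j, (e j : E → ℝ) =ᵐ[ν] φ j

/-- `g = ∑_j a_j φ_j`, with convergence in `L²(ν)`. -/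
def HasExpansion {E : Type*} [MeasurableSpace E] (ν : Measure E) (φ : ℕ → E → ℝ)
    (a : ℕ → ℝ) (g : E → ℝ) : Prop :=
  Tendsto (fun n : ℕ => eLpNorm (fun p => g p - ∑ j ∈ Finset.range n, a j * φ j p) 2 ν)
    atTop (𝓝 0)

/-- The ellipsoid `W(β, M)`; since `φ j` is the `(j+1)`-st basis function, the weights are
`(j+1)^{2β}`. -/
def ellipsoid {E : Type*} [MeasurableSpace E] (ν : Measure E) (φ : ℕ → E → ℝ) (β : ℕ) (M : ℝ) :
    Set (E → ℝ) :=
  {g | ∃ a : ℕ → ℝ, HasExpansion ν φ a g ∧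
    Summable (fun j : ℕ => ((j : ℝ) + 1) ^ (2 * β) * a j ^ 2) ∧
    ∑' j : ℕ, ((j : ℝ) + 1) ^ (2 * β) * a j ^ 2 ≤ M ^ 2}

/-- The `ℓ²` norm of a square-summable sequence. -/
def l2norm (a : ℕ → ℝ) : ℝ := Real.sqrt (∑' j, a j ^ 2)

/-- For every `t`, the law of `Z_t` has a density with respect to `μ` that is bounded by `D`. -/
def HasBoundedDensities {T : ℝ} {d : ℕ} (P : Measure Ω) (Z : Time T → Ω → Cube d)
    (μ : Measure (Cube d)) (D : ℝ) : Prop :=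
  ∀ t, ∃ h : Cube d → ENNReal, Measurable h ∧ (∀ᵐ z ∂μ, h z ≤ ENNReal.ofReal D) ∧
    P.map (Z t) = μ.withDensity h

end CoxClassification

end

open CoxClassification

/-!
Write `λ_±(s, z)` for the intensities and `p_±` for the probabilities of the labels. The minimal
risk is attained at the log-odds of the label given the stopped observations,
`L = log (p_+ / p_-) + ∫_0^{T ∧ τ} (λ_- - λ_+)(s, Z_s) ds + ∫_0^{T ∧ τ} log (λ_+ / λ_-)(s, Z_s) dX_s`,
because `exp L` is `p_+ / p_-` times the likelihood ratio of `(X^τ, Z)` between the two labels, and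
`L` is a measurable function of the stopped path and of `Z`. The element of `F_B`
that truncates both coefficient expansions after `B` terms, with constant `log (p_+ / p_-)`, is then
close to `L`: the logit loss is `2`-Lipschitz, so the excess risk is at most twice the mean of
`∫ |α|(s, Z_s) ds + ∫ |γ|(s, Z_s) dX_s` for the truncation errors `α` and `γ`. By the bound on the
densities and by Campbell's formula, this is at most `D ‖α‖₁ + D² ‖γ‖₁`, and the `L¹` norms are
bounded by the `L²` norms, which the ellipsoid controls (`sqrt_tail_le_of_ellipsoid`).

The probabilistic core is the likelihood ratio of the stopped path
(`IsCox.lintegral_eq_stoppedLikelihood`). The model only gives the law of the increments of `X`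
along finite grids, conditionally on the path of `Z`, which is a single random element `W` of which
`Z_s` is a jointly measurable function. Along a dyadic grid, the likelihood ratio up to the first
grid point with `X ≥ u` is an explicit finite product (`tsum_prod_reweight`,
`IsCox.measure_eq_gridLikelihood`); stopping `X` at `τ` is the same as capping it at `u`, so the
capped grid observations generate the stopped σ-algebra. As the grid is refined, the factor of a
jump at time `s` is the ratio of the averages of the two intensities over the dyadic interval around
`s`, which tends to `(λ_+ / λ_-)(s, Z_s)` for almost every `s` by Lebesgue's differentiation theorem,
hence at every jump time, almost surely, by Campbell's formula (`IsCox.campbell`). The ratios are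
dominated by `exp (D T) (D / ε) ^ X_T`, which is integrable.
-/

namespace CoxClassification

/-! ### Counting paths and their jump times -/

/-- The final time `T`, as an element of `[0,T]`. -/
def endTime (T : ℝ) [hT : Fact (0 < T)] : Time T := ⟨T, hT.out.le, le_rfl⟩

/-- The initial time `0`, as an element of `[0,T]`. -/
def startTime (T : ℝ) [hT : Fact (0 < T)] : Time T := ⟨0, le_rfl, hT.out.le⟩

section Paths

variable {T : ℝ} [hT : Fact (0 < T)]

lemma le_endTime (t : Time T) : t ≤ endTime T := t.2.2

lemma startTime_le (t : Time T) : startTime T ≤ t := t.2.1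

lemma firstTime_le {S : Set (Time T)} {s : Time T} (hs : s ∈ S) : firstTime S ≤ s := by
  change sInf _ ≤ (s : ℝ)
  refine csInf_le ⟨0, ?_⟩ (Set.mem_insert_of_mem _ ⟨s, hs, rfl⟩)
  rintro b (rfl | ⟨s, -, rfl⟩)
  · exact hT.out.le
  · exact s.2.1

lemma le_firstTime {S : Set (Time T)} {t : Time T} (h : ∀ s ∈ S, t ≤ s) : t ≤ firstTime S := by
  change (t : ℝ) ≤ sInf _
  refine le_csInf ⟨T, Set.mem_insert _ _⟩ ?_
  rintro b (rfl | ⟨s, hs, rfl⟩)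
  · exact t.2.2
  · exact h s hs

lemma firstTime_empty : firstTime (∅ : Set (Time T)) = endTime T :=
  le_antisymm (le_endTime _) (le_firstTime (by simp))

variable {x : Time T → ℕ}

/-- A counting path reaches each level at the first time it is at or above that level: it is
right-continuous, so it is at least `k` at that time, and it does not jump over `k`. -/
lemma IsCountingPath.apply_firstTime_ge (hx : IsCountingPath x) {k : ℕ}
    (hk : k ≤ x (endTime T)) : x (firstTime {s | k ≤ x s}) = k := by
  set s₀ := firstTime {s | k ≤ x s} with hs₀
  apply le_antisymm
  · rcases s₀.2.1.eq_or_lt with h0 | h0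
    · rw [hx.zero s₀ h0.symm]; exact Nat.zero_le _
    · obtain ⟨s, hs, hs'⟩ := hx.jump s₀ h0
      have : x s < k := by
        by_contra hc
        exact absurd (firstTime_le (S := {s | k ≤ x s}) (not_lt.1 hc)) (not_le.2 hs)
      omega
  · rcases (le_endTime s₀).eq_or_lt with he | he
    · rw [he]; exact hk
    by_contra hc
    have hev : ∀ᶠ s in 𝓝[≥] s₀, x s < k :=
      (hx.rightCont s₀).eventually_lt_const (not_le.1 hc)
    obtain ⟨r, hr, hr'⟩ := (mem_nhdsGE_iff_exists_Ico_subset' he).1 hev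
    refine absurd (le_firstTime (S := {s | k ≤ x s}) (t := r) fun s hs => ?_) (not_le.2 hr)
    by_contra hsr
    exact not_lt.2 (show k ≤ x s from hs) (hr' ⟨firstTime_le hs, not_le.1 hsr⟩)

lemma IsCountingPath.jumpTime_eq_firstTime_ge (hx : IsCountingPath x) {k : ℕ}
    (hk : k ≤ x (endTime T)) : jumpTime k x = firstTime {s | k ≤ x s} :=
  le_antisymm (firstTime_le (hx.apply_firstTime_ge hk))
    (le_firstTime fun _ hs => firstTime_le (le_of_eq hs.symm))

lemma IsCountingPath.apply_jumpTime (hx : IsCountingPath x) {k : ℕ}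
    (hk : k ≤ x (endTime T)) : x (jumpTime k x) = k := by
  rw [hx.jumpTime_eq_firstTime_ge hk, hx.apply_firstTime_ge hk]

lemma IsCountingPath.jumpTime_le_iff (hx : IsCountingPath x) {k : ℕ}
    (hk : k ≤ x (endTime T)) (t : Time T) : jumpTime k x ≤ t ↔ k ≤ x t := by
  refine ⟨fun h => ?_, fun h => ?_⟩
  · rw [← hx.apply_jumpTime hk]; exact hx.mono h
  · rw [hx.jumpTime_eq_firstTime_ge hk]; exact firstTime_le h

lemma IsCountingPath.lt_jumpTime_iff (hx : IsCountingPath x) {k : ℕ}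
    (hk : k ≤ x (endTime T)) (t : Time T) : t < jumpTime k x ↔ x t < k := by
  rw [← not_le, hx.jumpTime_le_iff hk, not_le]

lemma IsCountingPath.jumpTime_eq_endTime (hx : IsCountingPath x) {k : ℕ}
    (hk : x (endTime T) < k) : jumpTime k x = endTime T := by
  have : {t | x t = k} = ∅ := by
    ext t
    have := hx.mono (le_endTime t)
    simp only [Set.mem_ofPred_eq, Set.mem_empty_iff_false, iff_false]
    omega
  rw [jumpTime, this, firstTime_empty]

lemma IsCountingPath.apply_startTime (hx : IsCountingPath x) : x (startTime T) = 0 :=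
  hx.zero _ rfl

lemma IsCountingPath.startTime_lt_jumpTime (hx : IsCountingPath x) {k : ℕ} (hk0 : 0 < k)
    (hk : k ≤ x (endTime T)) : startTime T < jumpTime k x := by
  rw [hx.lt_jumpTime_iff hk, hx.apply_startTime]; exact hk0

lemma IsCountingPath.jumpTime_lt_jumpTime (hx : IsCountingPath x) {j k : ℕ} (hjk : j < k)
    (hk : k ≤ x (endTime T)) : jumpTime j x < jumpTime k x := by
  rw [hx.lt_jumpTime_iff hk, hx.apply_jumpTime (hjk.le.trans hk)]; exact hjk

lemma IsCountingPath.jumpTime_mono (hx : IsCountingPath x) {j k : ℕ} (hjk : j ≤ k) :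
    jumpTime j x ≤ jumpTime k x := by
  rcases le_or_gt k (x (endTime T)) with hk | hk
  · rw [hx.jumpTime_le_iff (hjk.trans hk), hx.apply_jumpTime hk]; exact hjk
  · rw [hx.jumpTime_eq_endTime hk]; exact le_endTime _

/-- Stopping a counting path at the time it reaches `u` amounts to capping it at `u`. -/
lemma IsCountingPath.apply_min_jumpTime (hx : IsCountingPath x) (u : ℕ) (t : Time T) :
    x (min t (jumpTime u x)) = min (x t) u := by
  rcases le_or_gt u (x (endTime T)) with hu | hu
  · rw [hx.mono.map_min, hx.apply_jumpTime hu]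
  · have := hx.mono (le_endTime t)
    rw [hx.jumpTime_eq_endTime hu, min_eq_left (le_endTime t), min_eq_left (by omega)]

lemma IsCountingPath.min_const {T : ℝ} {x : Time T → ℕ} (hx : IsCountingPath x) (u : ℕ) :
    IsCountingPath fun t => min (x t) u where
  zero t ht := by simp [hx.zero t ht]
  mono s t h := min_le_min_right _ (hx.mono h)
  rightCont t :=
    (continuous_of_discreteTopology
      (f := fun n : ℕ => min n u)).continuousAt.comp_continuousWithinAt (hx.rightCont t)
  jump t ht := by
    obtain ⟨s, hs, h⟩ := hx.jump t ht
    exact ⟨s, hs, by omega⟩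

lemma IsCountingPath.jumpTime_min_const (hx : IsCountingPath x) {k u : ℕ} (hku : k ≤ u) :
    jumpTime k (fun t => min (x t) u) = jumpTime k x := by
  rcases le_or_gt k (x (endTime T)) with hk | hk
  · refine eq_of_forall_ge_iff fun t => ?_
    rw [(hx.min_const u).jumpTime_le_iff (le_min hk hku), hx.jumpTime_le_iff hk]
    simp [hku]
  · rw [hx.jumpTime_eq_endTime hk, (hx.min_const u).jumpTime_eq_endTime (min_lt_of_left_lt hk)]

variable {d : ℕ}

lemma IsCountingPath.stopped_fst (hx : IsCountingPath x) (u : ℕ) (z : Time T → Cube d) :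
    (stopped u x z).1 = fun t => min (x t) u :=
  funext fun t => hx.apply_min_jumpTime u t

/-- The compensator part of a functional of the stopped paths only sees the paths up to `τ`. -/
lemma IsCountingPath.timeIntegral_stopped (hx : IsCountingPath x) (u : ℕ) (z : Time T → Cube d)
    (g : Time T × Cube d → ℝ) :
    timeIntegral u g (stopped u x z)
      = ∫ s in Set.Iic (jumpTime u x), g (s, z s) ∂(lebesgue T) := by
  rw [timeIntegral, hx.stopped_fst, hx.jumpTime_min_const le_rfl]
  refine setIntegral_congr_fun measurableSet_Iic fun s hs => ?_
  simp only [stopped, min_eq_left (Set.mem_Iic.1 hs)]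

lemma IsCountingPath.jumpIntegral_stopped (hx : IsCountingPath x) (u : ℕ) (z : Time T → Cube d)
    (g : Time T × Cube d → ℝ) :
    jumpIntegral u g (stopped u x z)
      = ∑ k ∈ Finset.Icc 1 (min (x (endTime T)) u), g (jumpTime k x, z (jumpTime k x)) := by
  have h1 : min (x (jumpTime u x)) u = min (x (endTime T)) u := by
    have := hx.apply_min_jumpTime u (endTime T)
    rw [min_eq_right (le_endTime _)] at this
    rw [this, min_assoc, min_self]
  rw [jumpIntegral, hx.stopped_fst, hx.jumpTime_min_const le_rfl]
  simp only [h1]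
  refine Finset.sum_congr rfl fun k hk => ?_
  have hku : k ≤ u := (Finset.mem_Icc.1 hk).2.trans (min_le_right _ _)
  rw [hx.jumpTime_min_const hku]
  simp only [stopped, min_eq_left (hx.jumpTime_mono hku)]

/-- A counting path with random parameter has measurable jump times, provided that the events
that the path has reached the given level by a given time are measurable. -/
lemma measurable_jumpTime {Ω : Type*} {m : MeasurableSpace Ω} {X : Time T → Ω → ℕ}
    (hX : ∀ ω, IsCountingPath fun t => X t ω) {k : ℕ}
    (hm : ∀ t, MeasurableSet[m] {ω | k ≤ X t ω}) :
    Measurable[m] fun ω => jumpTime k fun t => X t ω := by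
  refine measurable_of_Iic fun t => ?_
  have : (fun ω => jumpTime k fun t => X t ω) ⁻¹' Set.Iic t
      = {ω | k ≤ X t ω} ∪ ({ω | k ≤ X (endTime T) ω}ᶜ ∩ {_ω | t = endTime T}) := by
    ext ω
    simp only [Set.mem_preimage, Set.mem_Iic, Set.mem_union, Set.mem_ofPred_eq, Set.mem_inter_iff,
      Set.mem_compl_iff, not_le]
    rcases le_or_gt k (X (endTime T) ω) with hk | hk
    · rw [(hX ω).jumpTime_le_iff hk]; simp [hk.not_gt]
    · have := (hX ω).mono (le_endTime t)
      rw [(hX ω).jumpTime_eq_endTime hk]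
      have h2 : ¬ k ≤ X t ω := by omega
      simp only [hk, h2, true_and, false_or]
      exact ⟨fun h => le_antisymm (le_endTime t) h, fun h => h.ge⟩
  rw [this]
  exact (hm t).union ((hm _).compl.inter (MeasurableSet.const _))

end Paths

/-! ### Lebesgue measure on `[0,T]` and dyadic averages -/

lemma map_val_lebesgue (T : ℝ) :
    (lebesgue T).map Subtype.val = volume.restrict (Set.Icc 0 T) := by
  rw [lebesgue, map_comap_subtype_coe measurableSet_Icc]

lemma lebesgue_preimage {T : ℝ} {s : Set ℝ} (hs : MeasurableSet s) :
    lebesgue T (Subtype.val ⁻¹' s) = volume (s ∩ Set.Icc 0 T) := by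
  rw [← Measure.map_apply measurable_subtype_coe hs, map_val_lebesgue, Measure.restrict_apply hs]

lemma lebesgue_univ (T : ℝ) : lebesgue T Set.univ = ENNReal.ofReal T := by
  have := lebesgue_preimage (T := T) MeasurableSet.univ
  simpa using this

instance (T : ℝ) : IsFiniteMeasure (lebesgue T) := ⟨by simp [lebesgue_univ]⟩

lemma lebesgue_Ioc {T : ℝ} (a b : Time T) :
    lebesgue T (Set.Ioc a b) = ENNReal.ofReal (b - a) := by
  have h : Set.Ioc a b = Subtype.val ⁻¹' Set.Ioc (a : ℝ) b := rfl
  rw [h, lebesgue_preimage measurableSet_Ioc, Set.inter_eq_left.2, Real.volume_Ioc]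
  exact fun r hr => ⟨a.2.1.trans hr.1.le, hr.2.trans b.2.2⟩

lemma lebesgue_real_Ioc {T : ℝ} {a b : Time T} (h : a ≤ b) :
    (lebesgue T).real (Set.Ioc a b) = b - a := by
  rw [measureReal_def, lebesgue_Ioc, ENNReal.toReal_ofReal (sub_nonneg.2 h)]

lemma setIntegral_lebesgue_Ioc {T : ℝ} (G : ℝ → ℝ) (a b : Time T) :
    ∫ s in Set.Ioc a b, G s ∂(lebesgue T) = ∫ r in Set.Ioc (a : ℝ) b, G r := by
  have hemb := MeasurableEmbedding.subtype_coe (measurableSet_Icc (a := (0 : ℝ)) (b := T))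
  have h := hemb.setIntegral_map (μ := lebesgue T) G (Set.Ioc (a : ℝ) b)
  rw [map_val_lebesgue, Measure.restrict_restrict measurableSet_Ioc, Set.inter_eq_left.2] at h
  · exact h.symm
  · exact fun r hr => ⟨a.2.1.trans hr.1.le, hr.2.trans b.2.2⟩

section Grid

variable {T : ℝ} [hT : Fact (0 < T)]

lemma ae_startTime_lt : ∀ᵐ s ∂(lebesgue T), startTime T < s := by
  have : {s : Time T | ¬ startTime T < s} = Subtype.val ⁻¹' {(0 : ℝ)} := by
    ext s
    simp only [Set.mem_ofPred_eq, not_lt, Set.mem_preimage, Set.mem_singleton_iff]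
    exact ⟨fun h => le_antisymm h s.2.1, fun h => h.le⟩
  rw [ae_iff, this, lebesgue_preimage (measurableSet_singleton _)]
  exact measure_mono_null Set.inter_subset_left (by simp)

/-- The dyadic point `i T / 2 ^ n` of `[0,T]`, truncated at `T` for `i > 2 ^ n`. -/
noncomputable def gridPt (T : ℝ) [hT : Fact (0 < T)] (n i : ℕ) : Time T :=
  ⟨min T (i * T / 2 ^ n), le_min hT.out.le (by have := hT.out; positivity), min_le_left _ _⟩

/-- The index `i` of the dyadic interval `(i T / 2 ^ n, (i + 1) T / 2 ^ n]` that contains `s`. -/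
noncomputable def cell (n : ℕ) (s : Time T) : ℕ := ⌈(s : ℝ) * 2 ^ n / T⌉₊ - 1

lemma coe_gridPt {n i : ℕ} (hi : i ≤ 2 ^ n) : (gridPt T n i : ℝ) = i * T / 2 ^ n := by
  refine min_eq_right ?_
  have h : (i : ℝ) ≤ 2 ^ n := by exact_mod_cast hi
  have := hT.out
  rw [div_le_iff₀ (by positivity)]
  nlinarith

lemma gridPt_zero (n : ℕ) : gridPt T n 0 = startTime T := by
  apply Subtype.ext
  rw [coe_gridPt (Nat.zero_le _)]
  simp [startTime]

lemma gridPt_two_pow (n : ℕ) : gridPt T n (2 ^ n) = endTime T := by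
  apply Subtype.ext
  rw [coe_gridPt le_rfl]
  have := hT.out
  simp only [Nat.cast_pow, Nat.cast_ofNat, endTime]
  field_simp

lemma gridPt_mono (n : ℕ) : Monotone (gridPt T n) := by
  intro i j hij
  have := hT.out
  have h : (i : ℝ) ≤ j := by exact_mod_cast hij
  change min T _ ≤ min T _
  gcongr

lemma gridPt_succ_two_mul (n i : ℕ) : gridPt T (n + 1) (2 * i) = gridPt T n i := by
  apply Subtype.ext
  simp only [gridPt, Nat.cast_mul, Nat.cast_ofNat, pow_succ]
  congr 1
  field_simp

lemma mem_Ioc_cell {s : Time T} (hs : startTime T < s) (n : ℕ) :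
    s ∈ Set.Ioc (gridPt T n (cell n s)) (gridPt T n (cell n s + 1)) ∧ cell n s < 2 ^ n := by
  have hT := hT.out
  have hs0 : (0 : ℝ) < s := hs
  have h0 : 0 < (s : ℝ) * 2 ^ n / T := by positivity
  have hc : cell n s + 1 = ⌈(s : ℝ) * 2 ^ n / T⌉₊ := Nat.sub_add_cancel (Nat.ceil_pos.2 h0)
  have hle : ⌈(s : ℝ) * 2 ^ n / T⌉₊ ≤ 2 ^ n := by
    rw [Nat.ceil_le, div_le_iff₀ hT]
    have := s.2.2
    push_cast
    nlinarith [pow_pos (two_pos (α := ℝ)) n]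
  have hlt : cell n s < 2 ^ n := by omega
  refine ⟨⟨?_, ?_⟩, hlt⟩
  · change (gridPt T n (cell n s) : ℝ) < s
    rw [coe_gridPt hlt.le, div_lt_iff₀ (by positivity)]
    have : (cell n s : ℝ) < (s : ℝ) * 2 ^ n / T := Nat.lt_ceil.1 (by omega)
    rwa [lt_div_iff₀ hT] at this
  · change (s : ℝ) ≤ (gridPt T n (cell n s + 1) : ℝ)
    rw [coe_gridPt hlt, Nat.succ_eq_add_one, hc, le_div_iff₀ (by positivity), ← div_le_iff₀ hT]
    exact Nat.le_ceil _

lemma cell_eq_of_mem {s : Time T} {n i : ℕ}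
    (hs : s ∈ Set.Ioc (gridPt T n i) (gridPt T n (i + 1))) : cell n s = i := by
  have h0 : startTime T < s := (startTime_le _).trans_lt hs.1
  obtain ⟨⟨h1, h2⟩, -⟩ := mem_Ioc_cell h0 n
  by_contra hne
  rcases lt_or_gt_of_ne hne with h | h
  · exact absurd (h2.trans (gridPt_mono n (Nat.succ_le_of_lt h))) (not_le.2 hs.1)
  · exact absurd (hs.2.trans (gridPt_mono n (Nat.succ_le_of_lt h))) (not_le.2 h1)

/-- The left end of the dyadic interval of level `n` that contains `s`. -/
noncomputable def leftPt (n : ℕ) (s : Time T) : Time T := gridPt T n (cell n s)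

lemma leftPt_lt {s : Time T} (hs : startTime T < s) (n : ℕ) : leftPt n s < s :=
  (mem_Ioc_cell hs n).1.1

lemma eventually_le_leftPt {r s : Time T} (h : r < s) : ∀ᶠ n in atTop, r ≤ leftPt n s := by
  have hs : startTime T < s := (startTime_le _).trans_lt h
  have hT := hT.out
  have hrs : 0 < (s : ℝ) - r := sub_pos.2 h
  have hlim : Tendsto (fun n : ℕ => T * (1 / 2 : ℝ) ^ n) atTop (𝓝 0) := by
    simpa using (tendsto_pow_atTop_nhds_zero_of_lt_one (r := (1 / 2 : ℝ)) (by norm_num)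
      (by norm_num)).const_mul T
  filter_upwards [hlim.eventually_lt_const hrs] with n hn
  obtain ⟨⟨-, h2⟩, h3⟩ := mem_Ioc_cell hs n
  change (r : ℝ) ≤ (gridPt T n (cell n s) : ℝ)
  replace h2 : (s : ℝ) ≤ (gridPt T n (cell n s + 1) : ℝ) := h2
  rw [coe_gridPt h3] at h2
  rw [coe_gridPt h3.le]
  rw [one_div, inv_pow, ← div_eq_mul_inv] at hn
  push_cast at h2
  rw [add_mul, add_div, one_mul] at h2
  linarith

lemma measurable_cell {T : ℝ} (n : ℕ) : Measurable (cell (T := T) n) := by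
  unfold cell
  fun_prop

/-- The average of `g` over the dyadic interval of level `n` that contains `s`. -/
noncomputable def cellAverage (n : ℕ) (g : Time T → ℝ) (s : Time T) : ℝ :=
  2 ^ n / T * ∫ r in Set.Ioc (gridPt T n (cell n s)) (gridPt T n (cell n s + 1)), g r ∂(lebesgue T)

/-- Lebesgue's differentiation theorem along dyadic intervals. -/
lemma ae_tendsto_cellAverage {g : Time T → ℝ} (hg : Integrable g (lebesgue T)) :
    ∀ᵐ s ∂(lebesgue T), Tendsto (fun n => cellAverage n g s) atTop (𝓝 (g s)) := by
  have hT := hT.out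
  have hemb := MeasurableEmbedding.subtype_coe (measurableSet_Icc (a := (0 : ℝ)) (b := T))
  set G : ℝ → ℝ := Function.extend Subtype.val g 0 with hG
  have hGg : ∀ s : Time T, G s = g s := fun s => Subtype.val_injective.extend_apply _ _ s
  have hGint : Integrable G := by
    rw [← integrableOn_iff_integrable_of_support_subset (s := Set.Icc 0 T), IntegrableOn,
      ← map_val_lebesgue, hemb.integrable_map_iff]
    · exact hg.congr (ae_of_all _ fun s => (hGg s).symm)
    · intro r hr
      by_contra hc
      refine hr (Function.extend_apply' _ _ _ ?_)
      rintro ⟨a, rfl⟩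
      exact hc a.2
  have hae : ∀ᵐ r ∂((lebesgue T).map Subtype.val), ∀ (w δ : ℕ → ℝ),
      Tendsto δ atTop (𝓝[>] 0) → (∀ᶠ j in atTop, r ∈ Metric.closedBall (w j) (1 * δ j)) →
      Tendsto (fun j => ⨍ y in Metric.closedBall (w j) (δ j), G y) atTop (𝓝 (G r)) := by
    rw [map_val_lebesgue]
    refine ae_restrict_of_ae ?_
    filter_upwards [IsUnifLocDoublingMeasure.ae_tendsto_average volume hGint.locallyIntegrable 1]
      with r hr w δ h1 h2 using hr w δ h1 h2
  rw [hemb.ae_map_iff] at hae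
  filter_upwards [hae, ae_startTime_lt] with s hs hs0
  have hpos : ∀ n : ℕ, 0 < T / 2 ^ (n + 1) := fun n => by positivity
  have hmid : ∀ n : ℕ, (cell n s + 1 / 2 : ℝ) * T / 2 ^ n - T / 2 ^ (n + 1) = gridPt T n (cell n s)
      ∧ (cell n s + 1 / 2 : ℝ) * T / 2 ^ n + T / 2 ^ (n + 1) = gridPt T n (cell n s + 1) := by
    intro n
    obtain ⟨-, h3⟩ := mem_Ioc_cell hs0 n
    rw [coe_gridPt h3, coe_gridPt h3.le]
    push_cast
    constructor <;> field_simp <;> ring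
  have := hs (fun n => (cell n s + 1 / 2 : ℝ) * T / 2 ^ n) (fun n => T / 2 ^ (n + 1)) ?_ ?_
  · rw [hGg] at this
    refine this.congr fun n => ?_
    rw [Real.closedBall_eq_Icc, (hmid n).1, (hmid n).2, setAverage_eq, measureReal_def,
      Real.volume_Icc, integral_Icc_eq_integral_Ioc, cellAverage,
      ← setIntegral_lebesgue_Ioc, ← (hmid n).1, ← (hmid n).2, ENNReal.toReal_ofReal]
    · simp only [hGg, smul_eq_mul]
      congr 1
      field_simp
      ring
    · linarith [hpos n]
  · rw [tendsto_nhdsWithin_iff]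
    refine ⟨?_, Eventually.of_forall hpos⟩
    have : Tendsto (fun n : ℕ => T / 2 * (1 / 2 : ℝ) ^ n) atTop (𝓝 0) := by
      simpa using (tendsto_pow_atTop_nhds_zero_of_lt_one (r := (1 / 2 : ℝ)) (by norm_num)
        (by norm_num)).const_mul (T / 2)
    refine this.congr fun n => ?_
    rw [one_div, inv_pow, pow_succ]
    field_simp
  · refine Eventually.of_forall fun n => ?_
    rw [one_mul, Real.closedBall_eq_Icc, (hmid n).1, (hmid n).2]
    exact ⟨(mem_Ioc_cell hs0 n).1.1.le, (mem_Ioc_cell hs0 n).1.2⟩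

end Grid

/-! ### Reweighting independent increments up to the passage above a level -/

lemma tsum_fin_succ {N : ℕ} (F : (Fin (N + 1) → ℕ) → ENNReal) :
    ∑' k, F k = ∑' (k₀ : ℕ) (k : Fin N → ℕ), F (Fin.cons k₀ k) := by
  rw [← (Fin.consEquiv fun _ => ℕ).tsum_eq, ENNReal.tsum_prod']
  rfl

lemma tsum_prod_eq_one {N : ℕ} (p : Fin N → ℕ → ENNReal) (hp : ∀ i, ∑' k, p i k = 1) :
    ∑' k : Fin N → ℕ, ∏ i, p i (k i) = 1 := by
  induction N with
  | zero => simp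
  | succ N ih =>
    rw [tsum_fin_succ]
    simp only [Fin.prod_univ_succ, Fin.cons_zero, Fin.cons_succ, ENNReal.tsum_mul_left]
    rw [ih (fun i => p i.succ) fun i => hp _]
    simp [hp]

/-- Change of measure for independent integer increments, stopped when their partial sums reach
the level `u`: to integrate a functional that only depends on the partial sums capped at `u`, it is
enough to reweight the increments that start below `u`. -/
lemma tsum_prod_reweight {N : ℕ} (p q r : Fin N → ℕ → ENNReal) (hp : ∀ i, ∑' k, p i k = 1)
    (hq : ∀ i, ∑' k, q i k = 1) (hpq : ∀ i k, p i k = r i k * q i k) (u : ℕ)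
    (F : (Fin N → ℕ) → ENNReal)
    (hF : ∀ k k', (∀ j, min (Fin.partialSum k j) u = min (Fin.partialSum k' j) u) → F k = F k') :
    ∑' k : Fin N → ℕ, (∏ i, p i (k i)) * F k
      = ∑' k : Fin N → ℕ, (∏ i, q i (k i)) *
          ((∏ i, if Fin.partialSum k i.castSucc < u then r i (k i) else 1) * F k) := by
  induction N generalizing u with
  | zero => simp
  | succ N ih =>
    rcases Nat.eq_zero_or_pos u with rfl | hu
    · have hc : ∀ k, F k = F 0 := fun k => hF _ _ (by simp)
      simp only [hc _, Nat.not_lt_zero, if_false, Finset.prod_const_one, one_mul]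
      rw [ENNReal.tsum_mul_right, ENNReal.tsum_mul_right, tsum_prod_eq_one p hp,
        tsum_prod_eq_one q hq]
    rw [tsum_fin_succ, tsum_fin_succ]
    refine tsum_congr fun k₀ => ?_
    have hstep := ih (fun i => p i.succ) (fun i => q i.succ) (fun i => r i.succ) (fun i => hp _)
      (fun i => hq _) (fun i k => hpq _ k) (u - k₀) (fun k => F (Fin.cons k₀ k)) (by
        intro k k' h
        refine hF _ _ fun j => ?_
        refine Fin.cases (by simp) (fun j => ?_) j
        have := h j
        simp only [Fin.partialSum_succ', Fin.tail_cons, Fin.cons_zero]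
        omega)
    simp only [Fin.prod_univ_succ, Fin.cons_zero, Fin.cons_succ, mul_assoc, Fin.castSucc_zero,
      Fin.partialSum_zero, hu, if_true, Fin.castSucc_succ, Fin.partialSum_succ', Fin.tail_cons]
    simp only [← Nat.lt_sub_iff_add_lt']
    rw [ENNReal.tsum_mul_left, hstep, hpq, ENNReal.tsum_mul_left, mul_comm (r 0 k₀), mul_assoc,
      ← ENNReal.tsum_mul_left]
    congr 1
    refine tsum_congr fun k => ?_
    ring

/-! ### The likelihood ratio along a dyadic grid and its limit -/

section Likelihood

variable {T : ℝ} [hT : Fact (0 < T)]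

/-- The likelihood ratio, between the intensities `gp` and `gm`, of the increments of `x` along the
dyadic grid of level `n`, up to the first grid point where `x` is at or above `u`. -/
noncomputable def gridLikelihood (n u : ℕ) (gp gm : Time T → ℝ) (x : Time T → ℕ) : ℝ :=
  ∏ i ∈ Finset.range (2 ^ n),
    if x (gridPt T n i) < u then
      Real.exp (∫ s in Set.Ioc (gridPt T n i) (gridPt T n (i + 1)), (gm s - gp s) ∂(lebesgue T)) *
        ((∫ s in Set.Ioc (gridPt T n i) (gridPt T n (i + 1)), gp s ∂(lebesgue T)) /
          (∫ s in Set.Ioc (gridPt T n i) (gridPt T n (i + 1)), gm s ∂(lebesgue T)))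
          ^ (x (gridPt T n (i + 1)) - x (gridPt T n i))
    else 1

/-- The likelihood ratio between the intensities `gp` and `gm` of the path `x` stopped when it
reaches `u`. -/
noncomputable def stoppedLikelihood (u : ℕ) (gp gm : Time T → ℝ) (x : Time T → ℕ) : ℝ :=
  Real.exp (∫ s in Set.Iic (jumpTime u x), (gm s - gp s) ∂(lebesgue T)) *
    ∏ k ∈ Finset.Icc 1 (min (x (endTime T)) u), gp (jumpTime k x) / gm (jumpTime k x)

lemma integrable_ite_leftPt (n u : ℕ) {g : Time T → ℝ} (hg : Integrable g (lebesgue T))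
    (x : Time T → ℕ) :
    Integrable (fun s => if x (leftPt n s) < u then g s else 0) (lebesgue T) := by
  have hmeas : MeasurableSet {s : Time T | x (leftPt n s) < u} :=
    (measurable_cell n) (MeasurableSet.of_discrete (s := {i | x (gridPt T n i) < u}))
  exact (hg.indicator hmeas).congr (ae_of_all _ fun s => by simp [Set.indicator])

lemma setIntegral_leftPt (n u : ℕ) {g : Time T → ℝ} (hg : Integrable g (lebesgue T))
    (x : Time T → ℕ) {m : ℕ} :
    ∑ i ∈ Finset.range m, (if x (gridPt T n i) < u then
        ∫ s in Set.Ioc (gridPt T n i) (gridPt T n (i + 1)), g s ∂(lebesgue T) else 0)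
      = ∫ s in Set.Ioc (startTime T) (gridPt T n m),
          (if x (leftPt n s) < u then g s else 0) ∂(lebesgue T) := by
  have hint := integrable_ite_leftPt n u hg x
  induction m with
  | zero => simp [gridPt_zero]
  | succ m ih =>
    rw [Finset.sum_range_succ, ih, ← Set.Ioc_union_Ioc_eq_Ioc (startTime_le (gridPt T n m))
      (gridPt_mono n m.le_succ), setIntegral_union (Set.Ioc_disjoint_Ioc_of_le le_rfl)
      measurableSet_Ioc hint.integrableOn hint.integrableOn]
    congr 1
    have hc := setIntegral_congr_fun (μ := lebesgue T)
      (f := fun s => if x (leftPt n s) < u then g s else 0)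
      (g := fun s => if x (gridPt T n m) < u then g s else 0)
      (measurableSet_Ioc (a := gridPt T n m) (b := gridPt T n (m + 1)))
      fun s hs => by simp only [leftPt, cell_eq_of_mem hs]
    refine Eq.trans ?_ hc.symm
    split_ifs <;> simp

lemma IsCountingPath.prod_jumps_eq {x : Time T → ℕ} (hx : IsCountingPath x) (n : ℕ)
    (f : ℕ → ℝ) {m : ℕ} :
    ∏ i ∈ Finset.range m, f i ^ (x (gridPt T n (i + 1)) - x (gridPt T n i))
      = ∏ k ∈ Finset.Ioc 0 (x (gridPt T n m)), f (cell n (jumpTime k x)) := by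
  induction m with
  | zero => simp [gridPt_zero, hx.apply_startTime]
  | succ m ih =>
    have hmono := hx.mono (gridPt_mono n m.le_succ)
    rw [Finset.prod_range_succ, ih, ← Finset.prod_Ioc_consecutive _ (Nat.zero_le _) hmono]
    congr 1
    rw [← Nat.card_Ioc, ← Finset.prod_const]
    refine Finset.prod_congr rfl fun k hk => ?_
    rw [Finset.mem_Ioc] at hk
    have hkT : k ≤ x (endTime T) := hk.2.trans (hx.mono (le_endTime _))
    rw [cell_eq_of_mem (i := m)]
    exact ⟨(hx.lt_jumpTime_iff hkT _).2 hk.1, (hx.jumpTime_le_iff hkT _).2 hk.2⟩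

/-- The likelihood ratio along a grid, with its second factor written as a product over the jumps
of the path instead of the cells of the grid. -/
lemma IsCountingPath.gridLikelihood_eq {x : Time T → ℕ} (hx : IsCountingPath x) (n u : ℕ)
    {gp gm : Time T → ℝ} (hp : Integrable gp (lebesgue T)) (hm : Integrable gm (lebesgue T)) :
    gridLikelihood n u gp gm x =
      Real.exp (∫ s in Set.Ioc (startTime T) (endTime T),
          (if x (leftPt n s) < u then gm s - gp s else 0) ∂(lebesgue T)) *
        ∏ k ∈ Finset.Ioc 0 (x (endTime T)),
          if x (leftPt n (jumpTime k x)) < u then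
            cellAverage n gp (jumpTime k x) / cellAverage n gm (jumpTime k x) else 1 := by
  have h1 := setIntegral_leftPt n u (hm.sub hp) x (m := 2 ^ n)
  have h2 := hx.prod_jumps_eq n (m := 2 ^ n) fun i => if x (gridPt T n i) < u then
    (∫ s in Set.Ioc (gridPt T n i) (gridPt T n (i + 1)), gp s ∂(lebesgue T)) /
          (∫ s in Set.Ioc (gridPt T n i) (gridPt T n (i + 1)), gm s ∂(lebesgue T)) else 1
  have hc : (2 ^ n / T : ℝ) ≠ 0 := by have := hT.out; positivity
  rw [gridPt_two_pow] at h1 h2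
  simp only [Pi.sub_apply] at h1
  simp only [cellAverage, mul_div_mul_left _ _ hc, leftPt] at h1 ⊢
  rw [← h1, ← h2, Real.exp_sum, ← Finset.prod_mul_distrib, gridLikelihood]
  refine Finset.prod_congr rfl fun i _ => ?_
  split_ifs <;> simp

/-- Along dyadic grids, the likelihood ratios converge to the one of the stopped path, provided
that the jump times are points of differentiation of the integrals of both intensities. -/
lemma IsCountingPath.tendsto_gridLikelihood {x : Time T → ℕ} (hx : IsCountingPath x) (u : ℕ)
    {gp gm : Time T → ℝ} (hp : Integrable gp (lebesgue T)) (hm : Integrable gm (lebesgue T))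
    (hm0 : ∀ s, gm s ≠ 0)
    (hlp : ∀ k ∈ Finset.Icc 1 (x (endTime T)),
      Tendsto (fun n => cellAverage n gp (jumpTime k x)) atTop (𝓝 (gp (jumpTime k x))))
    (hlm : ∀ k ∈ Finset.Icc 1 (x (endTime T)),
      Tendsto (fun n => cellAverage n gm (jumpTime k x)) atTop (𝓝 (gm (jumpTime k x)))) :
    Tendsto (fun n => gridLikelihood n u gp gm x) atTop (𝓝 (stoppedLikelihood u gp gm x)) := by
  -- The grid point to the left of `s` is eventually at or after `τ` if `s > τ`, never if `s ≤ τ`.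
  have hleft : ∀ s, startTime T < s → ∀ᶠ n in atTop, (x (leftPt n s) < u ↔ s ≤ jumpTime u x) := by
    intro s hs
    rcases le_or_gt u (x (endTime T)) with hu | hu
    · rcases le_or_gt s (jumpTime u x) with h | h
      · refine Eventually.of_forall fun n => ?_
        simp only [h, iff_true]
        rw [← hx.lt_jumpTime_iff hu]
        exact (leftPt_lt hs n).trans_le h
      · filter_upwards [eventually_le_leftPt h] with n hn
        simp only [h.not_ge, iff_false, not_lt]
        rwa [← hx.jumpTime_le_iff hu]
    · refine Eventually.of_forall fun n => ?_
      rw [hx.jumpTime_eq_endTime hu]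
      simp only [le_endTime, iff_true]
      exact (hx.mono (le_endTime _)).trans_lt hu
  simp only [hx.gridLikelihood_eq _ u hp hm]
  rw [stoppedLikelihood]
  refine Tendsto.mul ((Real.continuous_exp.tendsto _).comp ?_) ?_
  · have hlim : ∫ s in Set.Iic (jumpTime u x), (gm s - gp s) ∂(lebesgue T)
        = ∫ s in Set.Ioc (startTime T) (endTime T),
          (if s ≤ jumpTime u x then gm s - gp s else 0) ∂(lebesgue T) := by
      have h1 : ∀ᵐ s ∂(lebesgue T), s ∈ Set.Ioc (startTime T) (endTime T) := by
        filter_upwards [ae_startTime_lt] with s hs using ⟨hs, le_endTime s⟩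
      rw [Measure.restrict_eq_self_of_ae_mem h1, ← integral_indicator measurableSet_Iic]
      rfl
    rw [hlim]
    refine tendsto_integral_of_dominated_convergence (fun s => ‖gm s - gp s‖) (fun n => ?_)
      (hm.sub hp).norm.integrableOn (fun n => Eventually.of_forall fun s => ?_) ?_
    · exact (integrable_ite_leftPt n u (hm.sub hp) x).integrableOn.aestronglyMeasurable
    · split_ifs <;> simp
    · filter_upwards [ae_restrict_mem measurableSet_Ioc] with s hs
      refine tendsto_const_nhds.congr' ?_
      filter_upwards [hleft s hs.1] with n hn
      simp only [hn]
  · have hset : ∏ k ∈ Finset.Icc 1 (min (x (endTime T)) u), gp (jumpTime k x) / gm (jumpTime k x)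
        = ∏ k ∈ Finset.Ioc 0 (x (endTime T)),
            if k ≤ u then gp (jumpTime k x) / gm (jumpTime k x) else 1 := by
      rw [← Finset.prod_filter]
      congr 1
      ext k
      simp only [Finset.mem_Icc, Finset.mem_filter, Finset.mem_Ioc]
      omega
    rw [hset]
    refine tendsto_finsetProd _ fun k hk => ?_
    rw [Finset.mem_Ioc] at hk
    have hk' : k ∈ Finset.Icc 1 (x (endTime T)) := Finset.mem_Icc.2 hk
    have hev : ∀ᶠ n in atTop, (x (leftPt n (jumpTime k x)) < u ↔ k ≤ u) := by
      filter_upwards [hleft _ (hx.startTime_lt_jumpTime hk.1 hk.2)] with n hn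
      rw [hn]
      refine ⟨fun h => ?_, fun h => hx.jumpTime_mono h⟩
      by_contra hc
      exact absurd (hx.jumpTime_lt_jumpTime (not_le.1 hc) hk.2) (not_lt.2 h)
    split_ifs with hku
    · refine ((hlp k hk').div (hlm k hk') (hm0 _)).congr' ?_
      filter_upwards [hev] with n hn
      simp [hn, hku]
    · refine tendsto_const_nhds.congr' ?_
      filter_upwards [hev] with n hn
      simp [hn, hku]

lemma const_mul_le_setIntegral_Ioc {T : ℝ} {g : Time T → ℝ} (hg : Integrable g (lebesgue T)) {ε : ℝ}
    (h : ∀ s, ε ≤ g s) {a b : Time T} (hab : a ≤ b) :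
    ε * (b - a) ≤ ∫ s in Set.Ioc a b, g s ∂(lebesgue T) := by
  have := setIntegral_mono (s := Set.Ioc a b) (integrable_const ε).integrableOn hg.integrableOn h
  rw [setIntegral_const, lebesgue_real_Ioc hab, smul_eq_mul, mul_comm] at this
  exact this

lemma setIntegral_Ioc_le_const_mul {T : ℝ} {g : Time T → ℝ} (hg : Integrable g (lebesgue T)) {D : ℝ}
    (h : ∀ s, g s ≤ D) {a b : Time T} (hab : a ≤ b) :
    ∫ s in Set.Ioc a b, g s ∂(lebesgue T) ≤ D * (b - a) := by
  have := setIntegral_mono (s := Set.Ioc a b) hg.integrableOn (integrable_const D).integrableOn h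
  rw [setIntegral_const, lebesgue_real_Ioc hab, smul_eq_mul, mul_comm] at this
  exact this

lemma gridPt_lt_succ {n i : ℕ} (hi : i < 2 ^ n) : gridPt T n i < gridPt T n (i + 1) := by
  change (gridPt T n i : ℝ) < (gridPt T n (i + 1) : ℝ)
  rw [coe_gridPt hi, coe_gridPt hi.le]
  have := hT.out
  push_cast
  gcongr
  linarith

lemma setIntegral_grid_pos {g : Time T → ℝ} (hg : Integrable g (lebesgue T)) {ε : ℝ} (hε : 0 < ε)
    (h : ∀ s, ε ≤ g s) {n i : ℕ} (hi : i < 2 ^ n) :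
    0 < ∫ s in Set.Ioc (gridPt T n i) (gridPt T n (i + 1)), g s ∂(lebesgue T) := by
  refine lt_of_lt_of_le ?_ (const_mul_le_setIntegral_Ioc hg h (gridPt_mono n i.le_succ))
  exact mul_pos hε (sub_pos.2 (gridPt_lt_succ hi))

lemma IsCountingPath.gridLikelihood_le {x : Time T → ℕ} (hx : IsCountingPath x) (n u : ℕ)
    {gp gm : Time T → ℝ} (hp : Integrable gp (lebesgue T)) (hm : Integrable gm (lebesgue T))
    {ε D : ℝ} (hε : 0 < ε) (hpI : ∀ s, gp s ∈ Set.Icc ε D) (hmI : ∀ s, gm s ∈ Set.Icc ε D) :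
    gridLikelihood n u gp gm x ≤ Real.exp (D * T) * (D / ε) ^ x (endTime T) := by
  have hT := hT.out
  have hD : ε ≤ D := (hpI (startTime T)).1.trans (hpI (startTime T)).2
  have hD1 : 1 ≤ D / ε := (one_le_div hε).2 hD
  rw [hx.gridLikelihood_eq n u hp hm]
  refine mul_le_mul (Real.exp_le_exp.2 ?_) ?_ (Finset.prod_nonneg fun k hk => ?_)
    (Real.exp_pos _).le
  · have h1 : ∫ s in Set.Ioc (startTime T) (endTime T),
        (if x (leftPt n s) < u then gm s - gp s else 0) ∂(lebesgue T)
          ≤ ∫ _s in Set.Ioc (startTime T) (endTime T), D ∂(lebesgue T) := by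
      refine setIntegral_mono (integrable_ite_leftPt n u (hm.sub hp) x).integrableOn
        (integrable_const D).integrableOn fun s => ?_
      have := (hpI s).1
      have := (hmI s).2
      simp only
      split_ifs <;> linarith
    refine h1.trans_eq ?_
    rw [setIntegral_const, lebesgue_real_Ioc (startTime_le _), smul_eq_mul, mul_comm]
    simp [startTime, endTime]
  all_goals
    have hpos : ∀ {k}, k ∈ Finset.Ioc 0 (x (endTime T)) → ∀ {g : Time T → ℝ},
        Integrable g (lebesgue T) → (∀ s, g s ∈ Set.Icc ε D) →
        cellAverage n g (jumpTime k x) ∈ Set.Icc ε D := by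
      intro k hk g hg hgI
      rw [Finset.mem_Ioc] at hk
      obtain ⟨-, h3⟩ := mem_Ioc_cell (hx.startTime_lt_jumpTime hk.1 hk.2) n
      have hle := gridPt_mono (T := T) n (cell n (jumpTime k x)).le_succ
      have hl := const_mul_le_setIntegral_Ioc hg (fun s => (hgI s).1) hle
      have hu := setIntegral_Ioc_le_const_mul hg (fun s => (hgI s).2) hle
      have hlen : (gridPt T n (cell n (jumpTime k x) + 1) : ℝ) - gridPt T n (cell n (jumpTime k x))
          = T / 2 ^ n := by
        rw [coe_gridPt h3, coe_gridPt h3.le]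
        push_cast
        ring
      simp only [Nat.succ_eq_add_one] at hl hu
      rw [hlen] at hl hu
      have hc : (0 : ℝ) < 2 ^ n / T := by positivity
      have hcc : (2 : ℝ) ^ n / T * (T / 2 ^ n) = 1 := by field_simp
      rw [cellAverage]
      constructor <;> nlinarith
  · have hcard := Finset.prod_const (D / ε) (s := Finset.Ioc 0 (x (endTime T)))
    rw [Nat.card_Ioc, tsub_zero] at hcard
    rw [← hcard]
    refine Finset.prod_le_prod (fun k hk => ?_) fun k hk => ?_
    · split_ifs
      · exact div_nonneg (hε.le.trans (hpos hk hp hpI).1) (hε.le.trans (hpos hk hm hmI).1)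
      · exact zero_le_one
    split_ifs
    · have h1 := hpos hk hp hpI
      have h2 := hpos hk hm hmI
      exact div_le_div₀ (hε.le.trans hD) h1.2 hε h2.1
    · exact hD1
  · split_ifs
    · exact div_nonneg (hε.le.trans (hpos hk hp hpI).1) (hε.le.trans (hpos hk hm hmI).1)
    · exact zero_le_one

end Likelihood

/-! ### Cox processes with a random parameter: the law of increments and Campbell's formula -/

/-- The mass at `k` of the Poisson distribution with mean `m`. -/
noncomputable def poissonWeight (m : ℝ) (k : ℕ) : ENNReal :=
  ENNReal.ofReal (Real.exp (-m) * m ^ k / (k.factorial : ℝ))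

lemma tsum_poissonWeight {m : ℝ} (hm : 0 ≤ m) : ∑' k, poissonWeight m k = 1 := by
  have h : HasSum (fun k : ℕ => Real.exp (-m) * m ^ k / (k.factorial : ℝ)) 1 :=
    hasSum_one_poissonMeasure ⟨m, hm⟩
  unfold poissonWeight
  rw [← ENNReal.ofReal_tsum_of_nonneg (fun k => by positivity) h.summable]
  simpa using congrArg ENNReal.ofReal h.tsum_eq

lemma tsum_poissonWeight_mul_self {m : ℝ} (hm : 0 ≤ m) :
    ∑' k, poissonWeight m k * k = ENNReal.ofReal m := by
  rw [tsum_eq_zero_add' ENNReal.summable]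
  have h : ∀ k : ℕ, poissonWeight m (k + 1) * ((k + 1 : ℕ) : ENNReal)
      = ENNReal.ofReal m * poissonWeight m k := by
    intro k
    rw [← ENNReal.ofReal_natCast, poissonWeight, poissonWeight,
      ← ENNReal.ofReal_mul (by positivity), ← ENNReal.ofReal_mul hm, Nat.factorial_succ, pow_succ]
    congr 1
    push_cast
    field_simp
  simp only [h, ENNReal.tsum_mul_left, tsum_poissonWeight hm]
  simp

lemma tsum_poissonWeight_mul_pow {m c : ℝ} (hm : 0 ≤ m) (hc : 0 ≤ c) :
    ∑' k, poissonWeight m k * ENNReal.ofReal c ^ k = ENNReal.ofReal (Real.exp ((c - 1) * m)) := by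
  have h : ∀ k : ℕ, poissonWeight m k * ENNReal.ofReal c ^ k
      = ENNReal.ofReal (Real.exp ((c - 1) * m)) * poissonWeight (c * m) k := by
    intro k
    rw [poissonWeight, poissonWeight, ← ENNReal.ofReal_pow hc, ← ENNReal.ofReal_mul (by positivity),
      ← ENNReal.ofReal_mul (by positivity)]
    congr 1
    have : Real.exp (-m) = Real.exp ((c - 1) * m) * Real.exp (-(c * m)) := by
      rw [← Real.exp_add]; congr 1; ring
    rw [this, mul_pow]
    ring
  simp only [h, ENNReal.tsum_mul_left, tsum_poissonWeight (mul_nonneg hc hm), mul_one]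

/-- The likelihood ratio of two Poisson distributions. -/
lemma poissonWeight_eq_mul {p m : ℝ} (hp : 0 < p) (hm : 0 < m) (k : ℕ) :
    poissonWeight p k = ENNReal.ofReal (Real.exp (m - p) * (p / m) ^ k) * poissonWeight m k := by
  rw [poissonWeight, poissonWeight, ← ENNReal.ofReal_mul (by positivity)]
  congr 1
  have : Real.exp (-p) = Real.exp (m - p) * Real.exp (-m) := by
    rw [← Real.exp_add]; congr 1; ring
  rw [this, div_pow]
  field_simp

lemma measurable_poissonWeight (k : ℕ) : Measurable fun m => poissonWeight m k := by
  unfold poissonWeight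
  fun_prop

variable {Ω S : Type*} [MeasurableSpace Ω] [MeasurableSpace S] {T : ℝ}

/-- Under the finite measure `Q`, the counting process `X` is, conditionally on the random element
`W`, a Poisson process with intensity `s ↦ g (s, W)`. -/
structure IsCox (Q : Measure Ω) (X : Time T → Ω → ℕ) (W : Ω → S) (g : Time T × S → ℝ) :
    Prop where
  measurable_X : ∀ t, Measurable (X t)
  measurable_W : Measurable W
  counting : ∀ ω, IsCountingPath fun t => X t ω
  measurable_g : Measurable g
  law : ∀ (N : ℕ) (t : Fin (N + 1) → Time T), Monotone t → ∀ (k : Fin N → ℕ) (A : Set S),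
    MeasurableSet A →
    Q ({ω | ∀ i : Fin N, X (t i.succ) ω = X (t i.castSucc) ω + k i} ∩ W ⁻¹' A)
      = ∫⁻ ω in W ⁻¹' A, ∏ i : Fin N, poissonWeight
          (∫ s in Set.Ioc (t i.castSucc) (t i.succ), g (s, W ω) ∂(lebesgue T)) (k i) ∂Q

lemma measurable_setIntegral_Ioc {g : Time T × S → ℝ} (hg : Measurable g) (a b : Time T) :
    Measurable fun w => ∫ s in Set.Ioc a b, g (s, w) ∂(lebesgue T) :=
  (StronglyMeasurable.integral_prod_right' (ν := (lebesgue T).restrict (Set.Ioc a b))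
    (f := fun q : S × Time T => g (q.2, q.1))
    (hg.comp measurable_swap).stronglyMeasurable).measurable

lemma integrable_section {g : Time T × S → ℝ} (hg : Measurable g) {ε D : ℝ} (hε : 0 < ε)
    (hgI : ∀ q, g q ∈ Set.Icc ε D) (w : S) : Integrable (fun s => g (s, w)) (lebesgue T) := by
  refine Integrable.of_bound (C := D) (hg.comp (by fun_prop)).aestronglyMeasurable
    (ae_of_all _ fun s => ?_)
  rw [Real.norm_of_nonneg (hε.le.trans (hgI _).1)]
  exact (hgI _).2

variable {Q : Measure Ω} {X : Time T → Ω → ℕ} {W : Ω → S} {g : Time T × S → ℝ}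

/-- The joint law of the parameter and of the increments of a Cox process along a grid. -/
lemma IsCox.lintegral_increments [IsFiniteMeasure Q] (h : IsCox Q X W g) {N : ℕ}
    {t : Fin (N + 1) → Time T}
    (ht : Monotone t) (F : (Fin N → ℕ) → S → ENNReal) (hF : ∀ k, Measurable (F k)) :
    ∫⁻ ω, F (fun i => X (t i.succ) ω - X (t i.castSucc) ω) (W ω) ∂Q
      = ∫⁻ ω, ∑' k : Fin N → ℕ, (∏ i, poissonWeight
          (∫ s in Set.Ioc (t i.castSucc) (t i.succ), g (s, W ω) ∂(lebesgue T)) (k i))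
            * F k (W ω) ∂Q := by
  set p : (Fin N → ℕ) → Ω → ENNReal := fun k ω => ∏ i, poissonWeight
    (∫ s in Set.Ioc (t i.castSucc) (t i.succ), g (s, W ω) ∂(lebesgue T)) (k i) with hp
  have hpm : ∀ k, Measurable (p k) := fun k => Finset.measurable_prod _ fun i _ =>
    (measurable_poissonWeight (k i)).comp
      ((measurable_setIntegral_Ioc h.measurable_g _ _).comp h.measurable_W)
  set E : (Fin N → ℕ) → Set Ω := fun k => {ω | ∀ i, X (t i.succ) ω = X (t i.castSucc) ω + k i}
    with hE
  have hX := h.measurable_X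
  have hEm : ∀ k, MeasurableSet (E k) := fun k => by
    have : E k = ⋂ i, {ω | X (t i.succ) ω = X (t i.castSucc) ω + k i} := by ext; simp [hE]
    rw [this]
    exact MeasurableSet.iInter fun i => measurableSet_eq_fun (hX _) ((hX _).add_const _)
  have hEk : ∀ k ω, ω ∈ E k ↔ k = fun i => X (t i.succ) ω - X (t i.castSucc) ω := by
    intro k ω
    simp only [hE, Set.mem_ofPred_eq, funext_iff]
    refine forall_congr' fun i => ?_
    have : X (t i.castSucc) ω ≤ X (t i.succ) ω := (h.counting ω).mono (ht i.castSucc_le_succ)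
    omega
  have hlaw : ∀ k, (Q.restrict (E k)).map W = (Q.withDensity (p k)).map W := by
    intro k
    ext A hA
    rw [Measure.map_apply h.measurable_W hA, Measure.map_apply h.measurable_W hA,
      Measure.restrict_apply (h.measurable_W hA), withDensity_apply _ (h.measurable_W hA),
      Set.inter_comm]
    exact h.law N t ht k A hA
  have hsum : ∀ ω, F (fun i => X (t i.succ) ω - X (t i.castSucc) ω) (W ω)
      = ∑' k, (E k).indicator (fun ω => F k (W ω)) ω := by
    intro ω
    rw [tsum_eq_single (fun i => X (t i.succ) ω - X (t i.castSucc) ω)]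
    · rw [Set.indicator_of_mem ((hEk _ _).2 rfl)]
    · intro k hk
      exact Set.indicator_of_notMem (fun hc => hk ((hEk _ _).1 hc)) _
  simp only [hsum]
  change _ = ∫⁻ ω, ∑' k, (p k * fun ω => F k (W ω)) ω ∂Q
  have hFW : ∀ k, Measurable fun ω => F k (W ω) := fun k => (hF k).comp h.measurable_W
  rw [lintegral_tsum fun k => ((hFW k).indicator (hEm k)).aemeasurable,
    lintegral_tsum fun k => ((hpm k).mul (hFW k)).aemeasurable]
  refine tsum_congr fun k => ?_
  rw [lintegral_indicator (hEm k), ← lintegral_map (hF k) h.measurable_W, hlaw k,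
    lintegral_map (hF k) h.measurable_W,
    lintegral_withDensity_eq_lintegral_mul _ (hpm k) (hFW k)]

lemma IsCox.lintegral_increment [IsFiniteMeasure Q] (h : IsCox Q X W g) {a b : Time T}
    (hab : a ≤ b) (F : ℕ → S → ENNReal) (hF : ∀ k, Measurable (F k)) :
    ∫⁻ ω, F (X b ω - X a ω) (W ω) ∂Q
      = ∫⁻ ω, ∑' k, poissonWeight (∫ s in Set.Ioc a b, g (s, W ω) ∂(lebesgue T)) k
            * F k (W ω) ∂Q := by
  have ht : Monotone ![a, b] := by
    rw [Fin.monotone_iff_le_succ]; simpa using hab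
  have := h.lintegral_increments ht (fun k => F (k 0)) fun k => hF _
  simp only [Fin.prod_univ_one] at this
  refine this.trans (lintegral_congr fun ω => ?_)
  exact (Equiv.funUnique (Fin 1) ℕ).tsum_eq
    fun k => poissonWeight (∫ s in Set.Ioc a b, g (s, W ω) ∂(lebesgue T)) k * F k (W ω)

variable [hT : Fact (0 < T)] {ε D : ℝ}

lemma sum_Icc_one_eq_tsum (N : ℕ) (f : ℕ → ENNReal) :
    ∑ k ∈ Finset.Icc 1 N, f k = ∑' k, if k + 1 ≤ N then f (k + 1) else 0 := by
  rw [tsum_eq_sum (s := Finset.range N)]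
  · rw [Finset.sum_ite_of_true fun k hk => Nat.succ_le_of_lt (Finset.mem_range.1 hk),
      Finset.range_eq_Ico, Finset.sum_Ico_add' f 0 N 1]
    rfl
  · intro k hk
    rw [if_neg]
    simpa using hk

lemma IsCox.setLIntegral_count [IsFiniteMeasure Q] (h : IsCox Q X W g) (hε : 0 < ε)
    (hgI : ∀ q, g q ∈ Set.Icc ε D) (t : Time T) {A : Set S} (hA : MeasurableSet A) :
    ∫⁻ ω in W ⁻¹' A, (X t ω : ENNReal) ∂Q
      = ∫⁻ ω in W ⁻¹' A, (∫⁻ s in Set.Iic t, ENNReal.ofReal (g (s, W ω)) ∂(lebesgue T)) ∂Q := by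
  have h1 := h.lintegral_increment (startTime_le t) (fun k => A.indicator fun _ => (k : ENNReal))
    fun k => measurable_const.indicator hA
  have h0 : ∀ ω, X (startTime T) ω = 0 := fun ω => (h.counting ω).apply_startTime
  have hAW := h.measurable_W hA
  simp only [h0, tsub_zero] at h1
  rw [← lintegral_indicator hAW, ← lintegral_indicator hAW]
  refine Eq.trans (lintegral_congr fun ω => ?_) (h1.trans (lintegral_congr fun ω => ?_))
  · rfl
  · by_cases hω : W ω ∈ A
    · have hint := integrable_section h.measurable_g hε hgI (W ω)
      have hnn : ∀ s, 0 ≤ g (s, W ω) := fun s => hε.le.trans (hgI _).1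
      simp only [Set.indicator, hω, Set.mem_preimage, if_true]
      rw [tsum_poissonWeight_mul_self (integral_nonneg hnn),
        ofReal_integral_eq_lintegral_ofReal hint.integrableOn (ae_of_all _ hnn)]
      refine setLIntegral_congr ?_
      filter_upwards [ae_startTime_lt (T := T)] with s hs
      refine propext ?_
      exact ⟨fun h => h.2, fun h => ⟨hs, h⟩⟩
    · simp [Set.indicator, hω]

lemma IsCox.measurable_jumpTime (h : IsCox Q X W g) (k : ℕ) :
    Measurable fun ω => jumpTime k fun t => X t ω :=
  CoxClassification.measurable_jumpTime h.counting fun t =>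
    measurableSet_le measurable_const (h.measurable_X t)

/-- **Campbell's formula**: the intensity of the random measure of the jump times of a Cox process,
together with its parameter. -/
lemma IsCox.campbell [IsFiniteMeasure Q] (h : IsCox Q X W g) (hε : 0 < ε)
    (hgI : ∀ q, g q ∈ Set.Icc ε D) {G : Time T × S → ENNReal} (hG : Measurable G) :
    ∫⁻ ω, ∑ k ∈ Finset.Icc 1 (X (endTime T) ω), G (jumpTime k (fun t => X t ω), W ω) ∂Q
      = ∫⁻ ω, ∫⁻ s, ENNReal.ofReal (g (s, W ω)) * G (s, W ω) ∂(lebesgue T) ∂Q := by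
  have hX := h.measurable_X
  have hW := h.measurable_W
  have hJ : ∀ k, Measurable fun ω => (jumpTime k (fun t => X t ω), W ω) := fun k =>
    (h.measurable_jumpTime k).prodMk hW
  have hR : ∀ k : ℕ, MeasurableSet {ω | k + 1 ≤ X (endTime T) ω} := fun k =>
    measurableSet_le measurable_const (hX _)
  have hgm : Measurable fun q => ENNReal.ofReal (g q) := h.measurable_g.ennreal_ofReal
  set m₁ : Measure (Time T × S) := Measure.sum fun k : ℕ =>
    (Q.restrict {ω | k + 1 ≤ X (endTime T) ω}).map
      (fun ω => (jumpTime (k + 1) (fun t => X t ω), W ω)) with hm₁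
  have hL : ∀ {G : Time T × S → ENNReal}, Measurable G → ∫⁻ q, G q ∂m₁
      = ∫⁻ ω, ∑ k ∈ Finset.Icc 1 (X (endTime T) ω), G (jumpTime k (fun t => X t ω), W ω) ∂Q := by
    intro G hG
    simp only [sum_Icc_one_eq_tsum]
    rw [hm₁, lintegral_sum_measure, lintegral_tsum]
    · refine tsum_congr fun k => ?_
      rw [lintegral_map hG (hJ _), ← lintegral_indicator (hR k)]
      simp only [Set.indicator, Set.mem_ofPred_eq]
    · intro k
      exact (Measurable.ite (hR k) (hG.comp (hJ _)) measurable_const).aemeasurable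
  set m₂ : Measure (Time T × S) :=
    ((lebesgue T).prod (Q.map W)).withDensity fun q => ENNReal.ofReal (g q) with hm₂
  have hR2 : ∀ {G : Time T × S → ENNReal}, Measurable G → ∫⁻ q, G q ∂m₂
      = ∫⁻ ω, ∫⁻ s, ENNReal.ofReal (g (s, W ω)) * G (s, W ω) ∂(lebesgue T) ∂Q := by
    intro G hG
    rw [hm₂, lintegral_withDensity_eq_lintegral_mul _ hgm hG,
      lintegral_prod_symm _ (hgm.mul hG).aemeasurable, lintegral_map _ hW]
    · rfl
    · exact (hgm.mul hG).lintegral_prod_left'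
  have hrect : ∀ (t : Time T) {A : Set S}, MeasurableSet A →
      m₁ (Set.Iic t ×ˢ A) = m₂ (Set.Iic t ×ˢ A) := by
    intro t A hA
    have hs : MeasurableSet (Set.Iic t ×ˢ A) := measurableSet_Iic.prod hA
    rw [← lintegral_indicator_one hs, ← lintegral_indicator_one hs,
      hL (measurable_one.indicator hs), hR2 (measurable_one.indicator hs)]
    refine Eq.trans ?_ ((h.setLIntegral_count hε hgI t hA).trans ?_)
    · rw [← lintegral_indicator (hW hA)]
      refine lintegral_congr fun ω => ?_
      have hc := h.counting ω
      have hle : X t ω ≤ X (endTime T) ω := hc.mono (le_endTime t)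
      by_cases hω : W ω ∈ A
      · have hk : ∀ k ∈ Finset.Icc 1 (X (endTime T) ω),
            (Set.Iic t ×ˢ A).indicator (1 : Time T × S → ENNReal)
              (jumpTime k (fun t => X t ω), W ω) = if k ≤ X t ω then 1 else 0 := by
          intro k hk
          simp only [Set.indicator, Set.mem_prod, Set.mem_Iic, hω, and_true, Pi.one_apply,
            hc.jumpTime_le_iff (Finset.mem_Icc.1 hk).2]
        rw [Finset.sum_congr rfl hk, ← Finset.sum_filter, Finset.sum_const, nsmul_one]
        simp only [Set.indicator, Set.mem_preimage, hω, if_true]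
        congr 1
        have : (Finset.Icc 1 (X (endTime T) ω)).filter (fun k => k ≤ X t ω)
            = Finset.Icc 1 (X t ω) := by
          ext k
          simp only [Finset.mem_filter, Finset.mem_Icc]
          omega
        rw [this]
        simp
      · simp [Set.indicator, hω]
    · rw [← lintegral_indicator (hW hA)]
      refine lintegral_congr fun ω => ?_
      by_cases hω : W ω ∈ A
      · simp only [Set.indicator, Set.mem_preimage, hω, if_true, Set.mem_prod, and_true,
          Set.mem_Iic, Pi.one_apply, mul_ite, mul_one, mul_zero]
        rw [← lintegral_indicator measurableSet_Iic]
        simp only [Set.indicator, Set.mem_Iic]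
      · simp [Set.indicator, hω]
  have hIic : Set.Iic (endTime T) = Set.univ := Set.eq_univ_of_forall le_endTime
  have hfin : IsFiniteMeasure m₂ := by
    refine isFiniteMeasure_withDensity (ne_of_lt ?_)
    refine (lintegral_mono fun q => ENNReal.ofReal_le_ofReal (hgI q).2).trans_lt ?_
    rw [lintegral_const]
    have : IsFiniteMeasure (Q.map W) := Measure.isFiniteMeasure_map Q W
    exact ENNReal.mul_lt_top ENNReal.ofReal_lt_top (measure_lt_top _ _)
  have heq : m₂ = m₁ := by
    refine Measure.ext_prod fun {B} {A} hB hA => ?_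
    have hmap : ∀ (m : Measure (Time T × S)) {B : Set (Time T)}, MeasurableSet B →
        ((m.restrict (Set.univ ×ˢ A)).map Prod.fst) B = m (B ×ˢ A) := by
      intro m B hB
      rw [Measure.map_apply measurable_fst hB, Measure.restrict_apply (measurable_fst hB)]
      congr 1
      ext q
      simp
    rw [← hmap m₂ hB, ← hmap m₁ hB]
    congr 1
    refine Measure.ext_of_Iic _ _ fun t => ?_
    rw [hmap _ measurableSet_Iic, hmap _ measurableSet_Iic, hrect t hA]
  rw [← hL hG, ← hR2 hG, heq]

/-- The jump times of a Cox process avoid sets of null time. -/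
lemma IsCox.ae_jumpTime [IsFiniteMeasure Q] (h : IsCox Q X W g) (hε : 0 < ε)
    (hgI : ∀ q, g q ∈ Set.Icc ε D) {p : Time T × S → Prop} (hp : MeasurableSet {q | p q})
    (hae : ∀ w, ∀ᵐ s ∂(lebesgue T), p (s, w)) :
    ∀ᵐ ω ∂Q, ∀ k ∈ Finset.Icc 1 (X (endTime T) ω), p (jumpTime k (fun t => X t ω), W ω) := by
  have hG : Measurable ({q | p q}ᶜ.indicator (1 : Time T × S → ENNReal)) :=
    measurable_one.indicator hp.compl
  have h0 := h.campbell hε hgI hG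
  have hz : ∀ ω, ∫⁻ s, ENNReal.ofReal (g (s, W ω)) *
      {q | p q}ᶜ.indicator (1 : Time T × S → ENNReal) (s, W ω) ∂(lebesgue T) = 0 := by
    intro ω
    refine (lintegral_congr_ae ?_).trans lintegral_zero
    filter_upwards [hae (W ω)] with s hs
    simp [hs]
  simp only [hz, lintegral_zero] at h0
  have hmeas : Measurable fun ω => ∑ k ∈ Finset.Icc 1 (X (endTime T) ω),
      {q | p q}ᶜ.indicator (1 : Time T × S → ENNReal) (jumpTime k (fun t => X t ω), W ω) := by
    simp only [sum_Icc_one_eq_tsum]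
    refine Measurable.tsum fun k => Measurable.ite
      (measurableSet_le measurable_const (h.measurable_X _)) ?_ measurable_const
    exact hG.comp ((h.measurable_jumpTime _).prodMk h.measurable_W)
  rw [lintegral_eq_zero_iff hmeas] at h0
  filter_upwards [h0] with ω hω k hk
  by_contra hc
  have := Finset.sum_eq_zero_iff.1 hω k hk
  simp [hc] at this

lemma IsCox.lintegral_pow_lt_top [IsFiniteMeasure Q] (h : IsCox Q X W g) (hε : 0 < ε)
    (hgI : ∀ q, g q ∈ Set.Icc ε D) {c : ℝ} (hc : 1 ≤ c) :
    ∫⁻ ω, ENNReal.ofReal (c ^ X (endTime T) ω) ∂Q < ⊤ := by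
  have h1 := h.lintegral_increment (le_endTime (startTime T)) (fun k _ => ENNReal.ofReal c ^ k)
    fun k => measurable_const
  have h0 : ∀ ω, X (startTime T) ω = 0 := fun ω => (h.counting ω).apply_startTime
  simp only [h0, tsub_zero] at h1
  simp only [ENNReal.ofReal_pow (zero_le_one.trans hc)]
  rw [h1]
  refine (lintegral_mono (g := fun _ => ENNReal.ofReal (Real.exp ((c - 1) * (D * T))))
    fun ω => ?_).trans_lt ?_
  · have hnn : ∀ s, 0 ≤ g (s, W ω) := fun s => hε.le.trans (hgI _).1
    have hle := setIntegral_Ioc_le_const_mul (integrable_section h.measurable_g hε hgI (W ω))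
      (fun s => (hgI (s, W ω)).2) (startTime_le (endTime T))
    have hlen : ((endTime T : Time T) : ℝ) - (startTime T : Time T) = T := by
      simp [startTime, endTime]
    rw [hlen] at hle
    simp only
    rw [tsum_poissonWeight_mul_pow (integral_nonneg hnn) (zero_le_one.trans hc)]
    refine ENNReal.ofReal_le_ofReal (Real.exp_le_exp.2 ?_)
    exact mul_le_mul_of_nonneg_left hle (sub_nonneg.2 hc)
  · rw [lintegral_const]
    exact ENNReal.mul_lt_top ENNReal.ofReal_lt_top (measure_lt_top _ _)

/-! ### The likelihood ratio of two Cox processes stopped at a level -/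

section ChangeOfMeasure

variable {Ω S : Type*} [MeasurableSpace S] {T : ℝ} [hT : Fact (0 < T)]

/-- The observations along the dyadic grid of level `n`: the path of `X`, capped at `u`, at the grid
points, and the parameter `W`. -/
noncomputable def gridObs (X : Time T → Ω → ℕ) (W : Ω → S) (u n : ℕ) (ω : Ω) :
    (Fin (2 ^ n + 1) → ℕ) × S :=
  (fun j => min (X (gridPt T n j) ω) u, W ω)

/-- The σ-algebra of the observations along the dyadic grid of level `n`. -/
@[reducible] noncomputable def gridSigma (X : Time T → Ω → ℕ) (W : Ω → S) (u n : ℕ) :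
    MeasurableSpace Ω :=
  MeasurableSpace.comap (gridObs X W u n) inferInstance

/-- The σ-algebra generated by the observations along all dyadic grids. For a counting process `X`,
this is the σ-algebra generated by `W` and by `X` stopped when it reaches `u`. -/
@[reducible] noncomputable def stoppedSigma (X : Time T → Ω → ℕ) (W : Ω → S) (u : ℕ) :
    MeasurableSpace Ω :=
  ⨆ n, gridSigma X W u n

variable {X : Time T → Ω → ℕ} {W : Ω → S} {u : ℕ}

lemma gridSigma_mono : Monotone (gridSigma X W u) := by
  refine monotone_nat_of_le_succ fun n => ?_
  have hr : ∀ j : Fin (2 ^ n + 1), 2 * (j : ℕ) < 2 ^ (n + 1) + 1 := fun j => by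
    have := j.2
    rw [pow_succ]
    omega
  have h : gridObs X W u n = (fun q : (Fin (2 ^ (n + 1) + 1) → ℕ) × S =>
      ((fun j : Fin (2 ^ n + 1) => q.1 ⟨2 * j, hr j⟩), q.2)) ∘ gridObs X W u (n + 1) := by
    funext ω
    simp only [gridObs, Function.comp, gridPt_succ_two_mul]
  rw [gridSigma, h, ← MeasurableSpace.comap_comp]
  refine MeasurableSpace.comap_mono (Measurable.comap_le ?_)
  fun_prop

lemma measurable_param_stoppedSigma : Measurable[stoppedSigma X W u] W := by
  have h : Measurable[gridSigma X W u 0] (gridObs X W u 0) := comap_measurable _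
  exact (measurable_snd.comp h).mono (le_iSup (gridSigma X W u) 0) le_rfl

lemma gridPt_min (n j : ℕ) : gridPt T n (min j (2 ^ n)) = gridPt T n j := by
  rcases le_total j (2 ^ n) with h | h
  · rw [min_eq_left h]
  · rw [min_eq_right h, gridPt_two_pow]
    exact le_antisymm ((gridPt_two_pow n).symm.le.trans (gridPt_mono n h)) (le_endTime _)

/-- By right-continuity, the capped path is determined by its values at dyadic times. -/
lemma measurableSet_le_stoppedSigma (hX : ∀ ω, IsCountingPath fun t => X t ω) {k : ℕ} (hk : k ≤ u)
    (t : Time T) : MeasurableSet[stoppedSigma X W u] {ω | k ≤ X t ω} := by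
  have hgrid : ∀ n j : ℕ, MeasurableSet[stoppedSigma X W u] {ω | k ≤ X (gridPt T n j) ω} := by
    intro n j
    refine (le_iSup (gridSigma X W u) n) _ ?_
    have hj : min j (2 ^ n) < 2 ^ n + 1 := by omega
    have h : Measurable[gridSigma X W u n] (gridObs X W u n) := comap_measurable _
    have h2 : Measurable fun q : (Fin (2 ^ n + 1) → ℕ) × S => q.1 ⟨min j (2 ^ n), hj⟩ := by
      fun_prop
    have h3 := (h2.comp h) (MeasurableSet.of_discrete (s := Set.Ici k))
    convert h3 using 1
    ext ω
    simp [gridObs, gridPt_min, hk]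
  have hset : {ω | k ≤ X t ω}
      = ⋂ n : ℕ, {ω | k ≤ X (gridPt T n (⌊(t : ℝ) * 2 ^ n / T⌋₊ + 1)) ω} := by
    have hT := hT.out
    have hlow : ∀ n : ℕ, t ≤ gridPt T n (⌊(t : ℝ) * 2 ^ n / T⌋₊ + 1) := by
      intro n
      refine le_min t.2.2 ?_
      rw [le_div_iff₀ (by positivity), ← div_le_iff₀ hT]
      push_cast
      exact (Nat.lt_floor_add_one _).le
    have hup : ∀ n : ℕ, (gridPt T n (⌊(t : ℝ) * 2 ^ n / T⌋₊ + 1) : ℝ) ≤ t + T / 2 ^ n := by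
      intro n
      refine (min_le_right _ _).trans ?_
      have h0 : 0 ≤ (t : ℝ) * 2 ^ n / T := div_nonneg (mul_nonneg t.2.1 (by positivity)) hT.le
      have h := Nat.floor_le h0
      rw [le_div_iff₀ hT] at h
      rw [div_le_iff₀ (by positivity), add_mul, div_mul_cancel₀ _ (by positivity)]
      push_cast
      linarith
    ext ω
    simp only [Set.mem_ofPred_eq, Set.mem_iInter]
    refine ⟨fun h n => h.trans ((hX ω).mono (hlow n)), fun h => ?_⟩
    have hend : k ≤ X (endTime T) ω := (h 0).trans ((hX ω).mono (le_endTime _))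
    rw [← (hX ω).jumpTime_le_iff hend]
    have hlim : Tendsto (fun n : ℕ => (t : ℝ) + T / 2 ^ n) atTop (𝓝 (t + 0)) := by
      refine tendsto_const_nhds.add ?_
      simpa [div_eq_mul_inv] using (tendsto_pow_atTop_nhds_zero_of_lt_one (r := (1 / 2 : ℝ))
        (by norm_num) (by norm_num)).const_mul T
    rw [add_zero] at hlim
    refine ge_of_tendsto' (f := fun n : ℕ => (t : ℝ) + T / 2 ^ n) hlim fun n => ?_
    exact le_trans (((hX ω).jumpTime_le_iff hend _).2 (h n)) (hup n)
  rw [hset]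
  exact MeasurableSet.iInter fun n => hgrid n _

variable [MeasurableSpace Ω]

lemma stoppedSigma_le (hX : ∀ t, Measurable (X t)) (hW : Measurable W) :
    stoppedSigma X W u ≤ ‹MeasurableSpace Ω› := by
  refine iSup_le fun n => Measurable.comap_le ?_
  exact (measurable_pi_lambda _ fun j => (hX _).min measurable_const).prodMk hW

lemma measurable_setIntegral_Iic {T : ℝ} {g : Time T × S → ℝ} (hg : Measurable g) {τ : Ω → Time T}
    (hτ : Measurable τ) (hW : Measurable W) :
    Measurable fun ω => ∫ s in Set.Iic (τ ω), g (s, W ω) ∂(lebesgue T) := by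
  have h : Measurable fun q : Ω × Time T => if q.2 ≤ τ q.1 then g (q.2, W q.1) else 0 :=
    Measurable.ite (measurableSet_le measurable_snd (hτ.comp measurable_fst))
      (hg.comp (measurable_snd.prodMk (hW.comp measurable_fst))) measurable_const
  have h2 := (StronglyMeasurable.integral_prod_right' (ν := lebesgue T)
    h.stronglyMeasurable).measurable
  convert h2 using 2 with ω
  rw [← integral_indicator measurableSet_Iic]
  simp only [Set.indicator, Set.mem_Iic]

lemma measurable_sum_jumps {g : Time T × S → ℝ} (hg : Measurable g) {N : Ω → ℕ}
    (hN : Measurable N) (hNu : ∀ ω, N ω ≤ u)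
    (hJ : ∀ k ≤ u, Measurable fun ω => jumpTime k fun t => X t ω) (hW : Measurable W) :
    Measurable fun ω => ∑ k ∈ Finset.Icc 1 (N ω), g (jumpTime k (fun t => X t ω), W ω) := by
  have h : ∀ ω, ∑ k ∈ Finset.Icc 1 (N ω), g (jumpTime k (fun t => X t ω), W ω)
      = ∑ k ∈ Finset.Icc 1 u, if k ≤ N ω then g (jumpTime k (fun t => X t ω), W ω) else 0 := by
    intro ω
    rw [← Finset.sum_filter]
    congr 1
    ext k
    have := hNu ω
    simp only [Finset.mem_Icc, Finset.mem_filter]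
    omega
  simp only [h]
  refine Finset.measurable_sum _ fun k hk => Measurable.ite
    (measurableSet_le measurable_const hN) ?_ measurable_const
  exact hg.comp ((hJ k (Finset.mem_Icc.1 hk).2).prodMk hW)

lemma measurable_min_of_measurableSet_le {N : Ω → ℕ}
    (hN : ∀ k ≤ u, MeasurableSet {ω | k ≤ N ω}) : Measurable fun ω => min (N ω) u := by
  refine measurable_of_Ici fun k => ?_
  rcases le_or_gt k u with hk | hk
  · convert hN k hk using 1
    ext ω
    simp [hk]
  · convert MeasurableSet.empty using 1
    ext ω
    simp [hk]

/-- The logarithm of the likelihood ratio between the intensities `gp` and `gm` of the path `x`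
stopped when it reaches `u`. -/
noncomputable def logLikelihood (u : ℕ) (gp gm : Time T → ℝ) (x : Time T → ℕ) : ℝ :=
  ∫ s in Set.Iic (jumpTime u x), (gm s - gp s) ∂(lebesgue T) +
    ∑ k ∈ Finset.Icc 1 (min (x (endTime T)) u), Real.log (gp (jumpTime k x) / gm (jumpTime k x))

lemma exp_logLikelihood {gp gm : Time T → ℝ} (hp : ∀ s, 0 < gp s) (hm : ∀ s, 0 < gm s)
    (u : ℕ) (x : Time T → ℕ) :
    Real.exp (logLikelihood u gp gm x) = stoppedLikelihood u gp gm x := by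
  rw [logLikelihood, stoppedLikelihood, Real.exp_add, Real.exp_sum]
  congr 1
  exact Finset.prod_congr rfl fun k _ => Real.exp_log (div_pos (hp _) (hm _))

lemma measurable_logLikelihood (hX : ∀ ω, IsCountingPath fun t => X t ω) (hW : Measurable W)
    (hXm : ∀ k ≤ u, ∀ t, MeasurableSet {ω | k ≤ X t ω})
    {gp gm : Time T × S → ℝ} (hp : Measurable gp) (hm : Measurable gm) :
    Measurable fun ω => logLikelihood u (fun s => gp (s, W ω)) (fun s => gm (s, W ω))
      (fun t => X t ω) := by
  have hJ : ∀ k ≤ u, Measurable fun ω => jumpTime k fun t => X t ω := fun k hk =>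
    measurable_jumpTime hX (hXm k hk)
  refine (measurable_setIntegral_Iic (hm.sub hp) (hJ u le_rfl) hW).add
    (measurable_sum_jumps (g := fun q => Real.log (gp q / gm q)) (by fun_prop)
      (N := fun ω => min (X (endTime T) ω) u) ?_ (fun ω => min_le_right _ _) hJ hW)
  exact measurable_min_of_measurableSet_le fun k hk => hXm k hk (endTime T)

lemma measurableSet_tendsto_cellAverage {g : Time T × S → ℝ} (hg : Measurable g) :
    MeasurableSet {q : Time T × S | Tendsto
      (fun n => cellAverage n (fun s => g (s, q.2)) q.1 - g q) atTop (𝓝 0)} := by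
  refine measurableSet_tendsto _ fun n => Measurable.sub ?_ hg
  have h : Measurable fun q : ℕ × S =>
      ∫ r in Set.Ioc (gridPt T n q.1) (gridPt T n (q.1 + 1)), g (r, q.2) ∂(lebesgue T) :=
    measurable_from_prod_countable_right fun i => by
      simpa only using measurable_setIntegral_Ioc hg (gridPt T n i) (gridPt T n (i + 1))
  have hcell : Measurable fun q : Time T × S => (cell n q.1, q.2) :=
    ((measurable_cell n).comp measurable_fst).prodMk measurable_snd
  simpa only [cellAverage, Function.comp_def] using (h.comp hcell).const_mul ((2 : ℝ) ^ n / T)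

variable {Qp Qm : Measure Ω} [IsFiniteMeasure Qp] [IsFiniteMeasure Qm] {gp gm : Time T × S → ℝ}
  {c : ENNReal} {ε D : ℝ}

lemma partialSum_increments {N : ℕ} {x : Fin (N + 1) → ℕ} (hx : Monotone x) (h0 : x 0 = 0)
    (j : Fin (N + 1)) :
    Fin.partialSum (fun i : Fin N => x i.succ - x i.castSucc) j = x j := by
  induction j using Fin.induction with
  | zero => simp [h0]
  | succ i ih =>
    rw [Fin.partialSum_succ, ih]
    exact Nat.add_sub_cancel' (hx i.castSucc_le_succ)

/-- The likelihood ratio of two Cox processes observed along a dyadic grid until they are at or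
above the level `u`. -/
lemma IsCox.measure_eq_gridLikelihood (hp : IsCox Qp X W gp) (hm : IsCox Qm X W gm)
    (hc : Qp.map W = c • Qm.map W) (hε : 0 < ε) (hpI : ∀ q, gp q ∈ Set.Icc ε D)
    (hmI : ∀ q, gm q ∈ Set.Icc ε D) (n : ℕ) {E : Set Ω}
    (hE : MeasurableSet[gridSigma X W u n] E) :
    Qp E = c * ∫⁻ ω in E, ENNReal.ofReal (gridLikelihood n u (fun s => gp (s, W ω))
      (fun s => gm (s, W ω)) (fun t => X t ω)) ∂Qm := by
  have hE' : MeasurableSet E := stoppedSigma_le hm.measurable_X hm.measurable_W _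
    (le_iSup (gridSigma X W u) n _ hE)
  obtain ⟨B, hB, rfl⟩ := hE
  set t : Fin (2 ^ n + 1) → Time T := fun j => gridPt T n j with ht_def
  have ht : Monotone t := fun i j hij => gridPt_mono n hij
  set I : (Time T × S → ℝ) → Fin (2 ^ n) → S → ℝ := fun g i w =>
    ∫ s in Set.Ioc (t i.castSucc) (t i.succ), g (s, w) ∂(lebesgue T) with hI
  set F : (Fin (2 ^ n) → ℕ) → S → ENNReal := fun k w =>
    B.indicator 1 ((fun j => min (Fin.partialSum k j) u), w) with hF
  set r : S → Fin (2 ^ n) → ℕ → ENNReal := fun w i k =>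
    ENNReal.ofReal (Real.exp (I gm i w - I gp i w) * (I gp i w / I gm i w) ^ k) with hr
  have hFm : ∀ k, Measurable (F k) := fun k =>
    (measurable_one.indicator hB).comp (measurable_const.prodMk measurable_id)
  have hIm : ∀ {g : Time T × S → ℝ}, Measurable g → ∀ i, Measurable (I g i) := fun hg i =>
    measurable_setIntegral_Ioc hg _ _
  have hrm : ∀ i k, Measurable fun w => r w i k := fun i k => by
    have h1 := hIm hp.measurable_g i
    have h2 := hIm hm.measurable_g i
    simp only [hr]
    fun_prop
  have hIpos : ∀ {g : Time T × S → ℝ}, Measurable g → (∀ q, g q ∈ Set.Icc ε D) → ∀ i w,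
      0 < I g i w := fun hg hgI i w =>
    setIntegral_grid_pos (integrable_section hg hε hgI w) hε (fun s => (hgI _).1) i.2
  have hps : ∀ ω (j : Fin (2 ^ n + 1)),
      Fin.partialSum (fun i : Fin (2 ^ n) => X (t i.succ) ω - X (t i.castSucc) ω) j
        = X (t j) ω := fun ω j =>
    partialSum_increments (x := fun j => X (t j) ω) (fun i j hij => (hm.counting ω).mono (ht hij))
      (by simp only [ht_def, Fin.val_zero, gridPt_zero, (hm.counting ω).apply_startTime]) j
  have hFE : ∀ ω, F (fun i => X (t i.succ) ω - X (t i.castSucc) ω) (W ω)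
      = (gridObs X W u n ⁻¹' B).indicator 1 ω := by
    intro ω
    simp only [hF, hps]
    rfl
  have hreweight : ∀ w, ∑' k : Fin (2 ^ n) → ℕ, (∏ i, poissonWeight (I gp i w) (k i)) * F k w
      = ∑' k : Fin (2 ^ n) → ℕ, (∏ i, poissonWeight (I gm i w) (k i)) *
          ((∏ i, if Fin.partialSum k i.castSucc < u then r w i (k i) else 1) * F k w) := by
    intro w
    refine tsum_prod_reweight _ _ _
      (fun i => tsum_poissonWeight (hIpos hp.measurable_g hpI i w).le)
      (fun i => tsum_poissonWeight (hIpos hm.measurable_g hmI i w).le)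
      (fun i k => poissonWeight_eq_mul (hIpos hp.measurable_g hpI i w)
        (hIpos hm.measurable_g hmI i w) k) u (fun k => F k w) ?_
    intro k k' h
    simp only [hF, h]
  have hΦm : Measurable fun w =>
      ∑' k : Fin (2 ^ n) → ℕ, (∏ i, poissonWeight (I gp i w) (k i)) * F k w :=
    Measurable.tsum fun k => (Finset.measurable_prod _ fun i _ =>
      (measurable_poissonWeight (k i)).comp (hIm hp.measurable_g i)).mul (hFm k)
  have hwm : ∀ k : Fin (2 ^ n) → ℕ, Measurable fun w =>
      (∏ i, if Fin.partialSum k i.castSucc < u then r w i (k i) else 1) * F k w := fun k =>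
    (Finset.measurable_prod _ fun i _ => by
      split_ifs
      · exact hrm i (k i)
      · exact measurable_const).mul (hFm k)
  calc Qp (gridObs X W u n ⁻¹' B)
      = ∫⁻ ω, F (fun i => X (t i.succ) ω - X (t i.castSucc) ω) (W ω) ∂Qp := by
        simp only [hFE]
        exact (lintegral_indicator_one hE').symm
    _ = ∫⁻ w, ∑' k : Fin (2 ^ n) → ℕ, (∏ i, poissonWeight (I gp i w) (k i)) * F k w
          ∂(Qp.map W) := by
        rw [hp.lintegral_increments ht F hFm, lintegral_map hΦm hp.measurable_W]
    _ = c * ∫⁻ ω, ∑' k : Fin (2 ^ n) → ℕ, (∏ i, poissonWeight (I gm i (W ω)) (k i)) *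
          ((∏ i, if Fin.partialSum k i.castSucc < u then r (W ω) i (k i) else 1) * F k (W ω))
            ∂Qm := by
        rw [hc, lintegral_smul_measure, lintegral_map hΦm hm.measurable_W, smul_eq_mul]
        simp only [hreweight]
    _ = _ := by
        rw [← hm.lintegral_increments ht (fun k w =>
          (∏ i, if Fin.partialSum k i.castSucc < u then r w i (k i) else 1) * F k w) hwm,
          ← lintegral_indicator hE']
        congr 1
        refine lintegral_congr fun ω => ?_
        rw [hFE]
        by_cases hω : ω ∈ gridObs X W u n ⁻¹' B
        · rw [Set.indicator_of_mem hω, Set.indicator_of_mem hω, Pi.one_apply, mul_one,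
            gridLikelihood, ENNReal.ofReal_prod_of_nonneg, Finset.prod_range]
          · refine Finset.prod_congr rfl fun i _ => ?_
            rw [hps]
            have hsub := integral_sub
              (integrable_section hm.measurable_g hε hmI (W ω)).integrableOn
              (integrable_section hp.measurable_g hε hpI (W ω)).integrableOn
              (μ := (lebesgue T).restrict (Set.Ioc (t i.castSucc) (t i.succ)))
            simp only [ht_def, Fin.val_castSucc, Fin.val_succ, hr, hI] at hsub ⊢
            rw [hsub]
            split_ifs <;> simp
          · intro i hi
            have hi' := Finset.mem_range.1 hi
            split_ifs
            · have h1 := hIpos hp.measurable_g hpI ⟨i, hi'⟩ (W ω)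
              have h2 := hIpos hm.measurable_g hmI ⟨i, hi'⟩ (W ω)
              exact mul_nonneg (Real.exp_pos _).le (pow_nonneg (div_pos h1 h2).le _)
            · exact zero_le_one
        · rw [Set.indicator_of_notMem hω, Set.indicator_of_notMem hω, mul_zero]

end ChangeOfMeasure

section StoppedChangeOfMeasure

variable {Ω S : Type*} [MeasurableSpace Ω] [MeasurableSpace S] {T : ℝ} [hT : Fact (0 < T)]
  {X : Time T → Ω → ℕ} {W : Ω → S} {u : ℕ}
  {Qp Qm : Measure Ω} [IsFiniteMeasure Qp] [IsFiniteMeasure Qm] {gp gm : Time T × S → ℝ}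
  {c : ENNReal} {ε D : ℝ}

/-- On events observed along some dyadic grid, the likelihood ratio of the stopped path is the limit
of the likelihood ratios along finer grids, which are dominated by an exponential of the total
number of jumps. -/
lemma IsCox.measure_eq_stoppedLikelihood (hp : IsCox Qp X W gp) (hm : IsCox Qm X W gm)
    (hc : Qp.map W = c • Qm.map W) (hε : 0 < ε) (hpI : ∀ q, gp q ∈ Set.Icc ε D)
    (hmI : ∀ q, gm q ∈ Set.Icc ε D) (hεD : ε ≤ D) (hcfin : c ≠ ⊤) {n₀ : ℕ} {E : Set Ω}
    (hE : MeasurableSet[gridSigma X W u n₀] E) :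
    Qp E = c * ∫⁻ ω in E, ENNReal.ofReal (stoppedLikelihood u (fun s => gp (s, W ω))
      (fun s => gm (s, W ω)) (fun t => X t ω)) ∂Qm := by
  have hX := hm.measurable_X
  have hip := fun ω => integrable_section hp.measurable_g hε hpI (W ω)
  have him := fun ω => integrable_section hm.measurable_g hε hmI (W ω)
  have hae : ∀ {g : Time T × S → ℝ}, Measurable g → (∀ q, g q ∈ Set.Icc ε D) →
      ∀ᵐ ω ∂Qm, ∀ k ∈ Finset.Icc 1 (X (endTime T) ω),
        Tendsto (fun n => cellAverage n (fun s => g (s, W ω)) (jumpTime k fun t => X t ω)) atTop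
          (𝓝 (g (jumpTime k (fun t => X t ω), W ω))) := by
    intro g hg hgI
    have h := hm.ae_jumpTime hε hmI (measurableSet_tendsto_cellAverage hg) fun w => by
      filter_upwards [ae_tendsto_cellAverage (integrable_section hg hε hgI w)] with s hs
      exact tendsto_sub_nhds_zero_iff.2 hs
    filter_upwards [h] with ω hω k hk
    exact tendsto_sub_nhds_zero_iff.1 (hω k hk)
  have hlim : Tendsto (fun n => ∫⁻ ω in E, ENNReal.ofReal (gridLikelihood n u
      (fun s => gp (s, W ω)) (fun s => gm (s, W ω)) (fun t => X t ω)) ∂Qm) atTop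
      (𝓝 (∫⁻ ω in E, ENNReal.ofReal (stoppedLikelihood u (fun s => gp (s, W ω))
        (fun s => gm (s, W ω)) (fun t => X t ω)) ∂Qm)) := by
    refine tendsto_lintegral_of_dominated_convergence
      (fun ω => ENNReal.ofReal (Real.exp (D * T) * (D / ε) ^ X (endTime T) ω))
      (fun n => Measurable.ennreal_ofReal ?_) (fun n => ae_of_all _ fun ω => ?_) ?_ ?_
    · have hW := hm.measurable_W
      have hI : ∀ {g : Time T × S → ℝ}, Measurable g → ∀ i, Measurable fun ω =>
          ∫ s in Set.Ioc (gridPt T n i) (gridPt T n (i + 1)), g (s, W ω) ∂(lebesgue T) :=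
        fun hg i => (measurable_setIntegral_Ioc hg _ _).comp hW
      refine Finset.measurable_prod _ fun i _ => Measurable.ite
        (measurableSet_lt (hX _) measurable_const) (Measurable.mul ?_ ?_) measurable_const
      · exact (hI (hm.measurable_g.sub hp.measurable_g) i).exp
      · exact ((hI hp.measurable_g i).div (hI hm.measurable_g i)).pow ((hX _).sub (hX _))
    · exact ENNReal.ofReal_le_ofReal ((hm.counting ω).gridLikelihood_le n u (hip ω) (him ω) hε
        (fun s => hpI _) fun s => hmI _)
    · have hD : 1 ≤ D / ε := (one_le_div hε).2 hεD
      simp only [ENNReal.ofReal_mul (Real.exp_pos _).le]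
      rw [lintegral_const_mul' _ _ ENNReal.ofReal_ne_top]
      refine ENNReal.mul_ne_top ENNReal.ofReal_ne_top (ne_of_lt ?_)
      exact (setLIntegral_le_lintegral _ _).trans_lt (hm.lintegral_pow_lt_top hε hmI hD)
    · refine ae_restrict_of_ae ?_
      filter_upwards [hae hp.measurable_g hpI, hae hm.measurable_g hmI] with ω h1 h2
      refine (ENNReal.continuous_ofReal.tendsto _).comp ?_
      exact (hm.counting ω).tendsto_gridLikelihood u (hip ω) (him ω)
        (fun s => (hε.trans_le (hmI _).1).ne') h1 h2
  refine tendsto_nhds_unique (tendsto_const_nhds.congr' ?_)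
    (ENNReal.Tendsto.const_mul hlim (Or.inr hcfin))
  filter_upwards [eventually_ge_atTop n₀] with n hn
  exact hp.measure_eq_gridLikelihood hm hc hε hpI hmI n (gridSigma_mono hn _ hE)

/-- **Change of measure** between two Cox processes with the same parameter law, up to the constant
`c`, on the σ-algebra of the parameter and of the path stopped at the level `u`. -/
lemma IsCox.lintegral_eq_stoppedLikelihood (hp : IsCox Qp X W gp) (hm : IsCox Qm X W gm)
    (hc : Qp.map W = c • Qm.map W) (hε : 0 < ε) (hpI : ∀ q, gp q ∈ Set.Icc ε D)
    (hmI : ∀ q, gm q ∈ Set.Icc ε D) (hεD : ε ≤ D) (hcfin : c ≠ ⊤) {H : Ω → ENNReal}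
    (hH : Measurable[stoppedSigma X W u] H) :
    ∫⁻ ω, H ω ∂Qp = c * ∫⁻ ω, ENNReal.ofReal (Real.exp (logLikelihood u (fun s => gp (s, W ω))
      (fun s => gm (s, W ω)) (fun t => X t ω))) * H ω ∂Qm := by
  have hle : stoppedSigma X W u ≤ ‹MeasurableSpace Ω› :=
    stoppedSigma_le hm.measurable_X hm.measurable_W
  have hexp : ∀ ω, Real.exp (logLikelihood u (fun s => gp (s, W ω))
      (fun s => gm (s, W ω)) (fun t => X t ω)) = stoppedLikelihood u (fun s => gp (s, W ω))
      (fun s => gm (s, W ω)) (fun t => X t ω) := fun ω =>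
    exp_logLikelihood (fun s => hε.trans_le (hpI _).1) (fun s => hε.trans_le (hmI _).1) _ _
  have hLm : Measurable fun ω => ENNReal.ofReal (Real.exp (logLikelihood u
      (fun s => gp (s, W ω)) (fun s => gm (s, W ω)) (fun t => X t ω))) :=
    (measurable_logLikelihood hm.counting hm.measurable_W (fun k _ t =>
      measurableSet_le measurable_const (hm.measurable_X t)) hp.measurable_g
      hm.measurable_g).exp.ennreal_ofReal
  set L : Ω → ENNReal := fun ω => ENNReal.ofReal (Real.exp (logLikelihood u
      (fun s => gp (s, W ω)) (fun s => gm (s, W ω)) (fun t => X t ω))) with hL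
  have hset : ∀ n, ∀ E, MeasurableSet[gridSigma X W u n] E →
      Qp.trim hle E = (c • Qm.withDensity L).trim hle E := by
    intro n E hE
    have hE' : MeasurableSet[stoppedSigma X W u] E := le_iSup (gridSigma X W u) n _ hE
    rw [trim_measurableSet_eq hle hE', trim_measurableSet_eq hle hE', Measure.smul_apply,
      withDensity_apply _ (hle _ hE'), smul_eq_mul,
      hp.measure_eq_stoppedLikelihood hm hc hε hpI hmI hεD hcfin hE]
    simp only [hL, hexp]
  have htrim : Qp.trim hle = (c • Qm.withDensity L).trim hle := by
    refine @ext_of_generate_finite Ω (stoppedSigma X W u) _ _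
      (⋃ n, {E | MeasurableSet[gridSigma X W u n] E}) ?_ ?_ (isFiniteMeasure_trim hle) ?_ ?_
    · rw [stoppedSigma, MeasurableSpace.measurableSpace_iSup_eq]
      congr 1
      ext E
      simp
    · exact isPiSystem_iUnion_of_monotone _
        (fun n => @MeasurableSpace.isPiSystem_measurableSet Ω (gridSigma X W u n))
        fun _ _ hmn E hE => gridSigma_mono hmn E hE
    · intro E hE
      obtain ⟨n, hn⟩ := Set.mem_iUnion.1 hE
      exact hset n E hn
    · exact hset 0 Set.univ (@MeasurableSet.univ _ (gridSigma X W u 0))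
  rw [← lintegral_trim hle hH, htrim, lintegral_trim hle hH, lintegral_smul_measure, smul_eq_mul,
    lintegral_withDensity_eq_lintegral_mul _ hLm (hH.mono hle le_rfl)]
  rfl

end StoppedChangeOfMeasure

/-! ### The logit loss -/

lemma logitLoss_nonneg (t : ℝ) : 0 ≤ logitLoss t :=
  Real.logb_nonneg one_lt_two (by linarith [Real.exp_pos t])

lemma measurable_logitLoss : Measurable logitLoss := by
  unfold logitLoss Real.logb
  fun_prop

/-- The logit loss is Lipschitz with constant `1 / log 2 ≤ 2`. -/
lemma logitLoss_le_add (s t : ℝ) : logitLoss s ≤ logitLoss t + 2 * |s - t| := by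
  have hlog : (1 / 2 : ℝ) ≤ Real.log 2 := by linarith [Real.log_two_gt_d9]
  have h1 : 1 + Real.exp s ≤ Real.exp |s - t| * (1 + Real.exp t) := by
    have ha : Real.exp s ≤ Real.exp |s - t| * Real.exp t := by
      rw [← Real.exp_add]
      exact Real.exp_le_exp.2 (by linarith [le_abs_self (s - t)])
    have hb : 1 ≤ Real.exp |s - t| := Real.one_le_exp (abs_nonneg _)
    linarith
  have h2 : Real.log (1 + Real.exp s) ≤ |s - t| + Real.log (1 + Real.exp t) := by
    rw [← Real.log_exp |s - t|, ← Real.log_mul (Real.exp_pos _).ne' (by positivity)]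
    exact Real.log_le_log (by positivity) h1
  unfold logitLoss Real.logb
  rw [← sub_le_iff_le_add', ← sub_div, div_le_iff₀ (by linarith)]
  nlinarith [abs_nonneg (s - t)]

/-- Pointwise, the conditional logit risk with log-odds `l` is minimal at `l`. -/
lemma logitLoss_log_odds_le (l f : ℝ) :
    Real.exp l * logitLoss (-l) + logitLoss l ≤ Real.exp l * logitLoss (-f) + logitLoss f := by
  have hl2 : 0 < Real.log 2 := Real.log_pos one_lt_two
  -- Bound both log-ratios by `log y ≤ y - 1`; the resulting upper bounds cancel exactly.
  have key : Real.exp l * Real.log (1 + Real.exp (-l)) + Real.log (1 + Real.exp l)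
      ≤ Real.exp l * Real.log (1 + Real.exp (-f)) + Real.log (1 + Real.exp f) := by
    have h1 := Real.log_le_sub_one_of_pos
      (x := (1 + Real.exp (-l)) / (1 + Real.exp (-f))) (by positivity)
    have h2 := Real.log_le_sub_one_of_pos
      (x := (1 + Real.exp l) / (1 + Real.exp f)) (by positivity)
    rw [Real.log_div (by positivity) (by positivity)] at h1 h2
    have h3 : Real.exp l * ((1 + Real.exp (-l)) / (1 + Real.exp (-f)) - 1)
        + ((1 + Real.exp l) / (1 + Real.exp f) - 1) = 0 := by
      rw [Real.exp_neg, Real.exp_neg]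
      have := Real.exp_pos l
      have := Real.exp_pos f
      field_simp
      ring
    nlinarith [mul_le_mul_of_nonneg_left h1 (Real.exp_pos l).le]
  have hdiv := div_le_div_of_nonneg_right key hl2.le
  unfold logitLoss Real.logb
  rw [add_div, add_div, mul_div_assoc, mul_div_assoc] at hdiv
  exact hdiv

/-! ### Truncation of orthonormal expansions -/

section Expansion

variable {E : Type*} [MeasurableSpace E] {ν : Measure E} {φ : ℕ → E → ℝ}

lemma IsOrthonormalBasis.eLpNorm_sum (h : IsOrthonormalBasis ν φ) (s : Finset ℕ) (c : ℕ → ℝ) :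
    eLpNorm (fun p => ∑ j ∈ s, c j * φ j p) 2 ν
      = ENNReal.ofReal (Real.sqrt (∑ j ∈ s, c j ^ 2)) := by
  obtain ⟨e, he⟩ := h
  have hae : (fun p => ∑ j ∈ s, c j * φ j p) =ᵐ[ν] ((∑ j ∈ s, c j • e j : Lp ℝ 2 ν) : E → ℝ) := by
    have h1 : ∀ᵐ p ∂ν, ∀ j, (c j • e j : Lp ℝ 2 ν) p = c j * φ j p := by
      rw [ae_all_iff]
      intro j
      filter_upwards [Lp.coeFn_smul (c j) (e j), he j] with p h1 h2
      rw [h1, Pi.smul_apply, h2, smul_eq_mul]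
    filter_upwards [Lp.coeFn_finsetSum s (fun j => (c j • e j : Lp ℝ 2 ν)), h1] with p h2 h3
    rw [h2, Finset.sum_apply]
    exact Finset.sum_congr rfl fun j _ => (h3 j).symm
  rw [eLpNorm_congr_ae hae, ← Lp.enorm_def, ← ofReal_norm]
  congr 1
  rw [← Real.sqrt_sq (norm_nonneg (∑ j ∈ s, c j • e j)), ← real_inner_self_eq_norm_sq,
    e.orthonormal.inner_sum]
  simp [sq]

lemma aestronglyMeasurable_sum_const_mul (hφ : ∀ j, Measurable (φ j)) (s : Finset ℕ)
    (c : ℕ → ℝ) : AEStronglyMeasurable (fun p => ∑ j ∈ s, c j * φ j p) ν :=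
  (Finset.measurable_sum _ fun j _ => (hφ j).const_mul _).aestronglyMeasurable

lemma HasExpansion.unique (h : IsOrthonormalBasis ν φ) (hφ : ∀ j, Measurable (φ j)) {g : E → ℝ}
    (hg : Measurable g) {a a' : ℕ → ℝ} (ha : HasExpansion ν φ a g) (ha' : HasExpansion ν φ a' g) :
    a = a' := by
  funext j
  have hle : ∀ n, j < n → ENNReal.ofReal |a j - a' j|
      ≤ eLpNorm (fun p => g p - ∑ j ∈ Finset.range n, a' j * φ j p) 2 ν
        + eLpNorm (fun p => g p - ∑ j ∈ Finset.range n, a j * φ j p) 2 ν := by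
    intro n hn
    have h1 := eLpNorm_sub_le (p := 2)
      (hg.aestronglyMeasurable.sub (aestronglyMeasurable_sum_const_mul (ν := ν) hφ
        (Finset.range n) a'))
      (hg.aestronglyMeasurable.sub (aestronglyMeasurable_sum_const_mul (ν := ν) hφ
        (Finset.range n) a)) one_le_two
    refine le_trans ?_ h1
    have h2 := h.eLpNorm_sum (Finset.range n) (fun j => a j - a' j)
    have h3 : (fun p => ∑ j ∈ Finset.range n, (a j - a' j) * φ j p)
        = (g - fun p => ∑ j ∈ Finset.range n, a' j * φ j p)
          - (g - fun p => ∑ j ∈ Finset.range n, a j * φ j p) := by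
      funext p
      simp only [Pi.sub_apply, sub_mul, Finset.sum_sub_distrib]
      ring
    rw [← h3, h2]
    refine ENNReal.ofReal_le_ofReal (Real.abs_le_sqrt ?_)
    exact Finset.single_le_sum (f := fun j => (a j - a' j) ^ 2) (fun i _ => sq_nonneg _)
      (Finset.mem_range.2 hn)
  have h0 := ge_of_tendsto (ha'.add ha) (eventually_atTop.2 ⟨j + 1, fun n hn => hle n hn⟩)
  rw [add_zero, nonpos_iff_eq_zero, ENNReal.ofReal_eq_zero] at h0
  exact sub_eq_zero.1 (abs_nonpos_iff.1 h0)

lemma HasExpansion.eLpNorm_truncation_le (h : IsOrthonormalBasis ν φ) (hφ : ∀ j, Measurable (φ j))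
    {g : E → ℝ} (hg : Measurable g) {a : ℕ → ℝ} (ha : HasExpansion ν φ a g)
    (hs : Summable fun j => a j ^ 2) (B : ℕ) :
    eLpNorm (fun p => g p - ∑ j ∈ Finset.range B, a j * φ j p) 2 ν
      ≤ ENNReal.ofReal (Real.sqrt (∑' j, a (j + B) ^ 2)) := by
  have hle : ∀ n, B ≤ n → eLpNorm (fun p => g p - ∑ j ∈ Finset.range B, a j * φ j p) 2 ν
      ≤ eLpNorm (fun p => g p - ∑ j ∈ Finset.range n, a j * φ j p) 2 ν
        + ENNReal.ofReal (Real.sqrt (∑' j, a (j + B) ^ 2)) := by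
    intro n hn
    have h1 := eLpNorm_add_le (p := 2)
      (hg.aestronglyMeasurable.sub (aestronglyMeasurable_sum_const_mul (ν := ν) hφ
        (Finset.range n) a))
      (aestronglyMeasurable_sum_const_mul (ν := ν) hφ (Finset.Ico B n) a) one_le_two
    have h3 : (fun p => g p - ∑ j ∈ Finset.range B, a j * φ j p)
        = (g - fun p => ∑ j ∈ Finset.range n, a j * φ j p)
          + fun p => ∑ j ∈ Finset.Ico B n, a j * φ j p := by
      funext p
      simp only [Pi.sub_apply, Pi.add_apply, Finset.sum_Ico_eq_sub _ hn]
      ring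
    rw [h.eLpNorm_sum] at h1
    rw [h3]
    refine h1.trans (add_le_add le_rfl (ENNReal.ofReal_le_ofReal (Real.sqrt_le_sqrt ?_)))
    rw [Finset.sum_Ico_eq_sum_range]
    simp only [add_comm B]
    exact ((summable_nat_add_iff B).2 hs).sum_le_tsum _ fun i _ => sq_nonneg _
  have h0 := ge_of_tendsto (ha.add tendsto_const_nhds)
    (eventually_atTop.2 ⟨B, fun n hn => hle n hn⟩)
  rwa [zero_add] at h0

end Expansion

section Ellipsoid

variable {a : ℕ → ℝ} {β : ℕ} {M : ℝ}

lemma le_ellipsoid_weight (a : ℕ → ℝ) (β j : ℕ) : a j ^ 2 ≤ ((j : ℝ) + 1) ^ (2 * β) * a j ^ 2 :=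
  le_mul_of_one_le_left (sq_nonneg _)
    (one_le_pow₀ (by linarith [Nat.cast_nonneg (α := ℝ) j]))

lemma summable_sq_of_ellipsoid (hs : Summable fun j : ℕ => ((j : ℝ) + 1) ^ (2 * β) * a j ^ 2) :
    Summable fun j => a j ^ 2 :=
  hs.of_nonneg_of_le (fun _ => sq_nonneg _) (le_ellipsoid_weight a β)

lemma sum_abs_le_of_ellipsoid (hs : Summable fun j : ℕ => ((j : ℝ) + 1) ^ (2 * β) * a j ^ 2)
    (hM : ∑' j : ℕ, ((j : ℝ) + 1) ^ (2 * β) * a j ^ 2 ≤ M ^ 2) {B : ℕ} (hB : M ^ 2 ≤ B) :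
    ∑ j ∈ Finset.range B, |a j| ≤ B := by
  have h1 := sq_sum_le_card_mul_sum_sq (s := Finset.range B) (f := fun j => |a j|)
  simp only [sq_abs, Finset.card_range] at h1
  have h2 : ∑ j ∈ Finset.range B, a j ^ 2 ≤ M ^ 2 :=
    ((Finset.sum_le_sum fun j _ => le_ellipsoid_weight a β j).trans
      (hs.sum_le_tsum _ fun j _ => by positivity)).trans hM
  have h3 : (0 : ℝ) ≤ B := Nat.cast_nonneg B
  refine abs_le_of_sq_le_sq' ?_ h3 |>.2
  nlinarith

/-- The tail of a sequence in the ellipsoid, bounded by the geometric mean of its `ℓ²` norm and of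
the radius of the ellipsoid. -/
lemma sqrt_tail_le_of_ellipsoid (hMpos : 0 < M)
    (hs : Summable fun j : ℕ => ((j : ℝ) + 1) ^ (2 * β) * a j ^ 2)
    (hM : ∑' j : ℕ, ((j : ℝ) + 1) ^ (2 * β) * a j ^ 2 ≤ M ^ 2) {B : ℕ} (hB : 0 < B) :
    Real.sqrt (∑' j, a (j + B) ^ 2)
      ≤ Real.sqrt (M * l2norm a) / (B : ℝ) ^ ((β : ℝ) / 2) := by
  have hs2 := summable_sq_of_ellipsoid hs
  have hsB := (summable_nat_add_iff B).2 hs2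
  have hwB := (summable_nat_add_iff B).2 hs
  have hB0 : (0 : ℝ) < B := Nat.cast_pos.2 hB
  set t := ∑' j, a (j + B) ^ 2 with ht
  have ht0 : 0 ≤ t := tsum_nonneg fun j => sq_nonneg _
  have h1 : t ≤ ∑' j, a j ^ 2 := by
    rw [← hs2.sum_add_tsum_nat_add B]
    exact le_add_of_nonneg_left (Finset.sum_nonneg fun j _ => sq_nonneg _)
  have h2 : (B : ℝ) ^ (2 * β) * t ≤ M ^ 2 := by
    rw [ht, ← tsum_mul_left]
    refine le_trans ?_ hM
    rw [← hs.sum_add_tsum_nat_add B]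
    refine le_trans ?_ (le_add_of_nonneg_left (Finset.sum_nonneg fun j _ => by positivity))
    refine (hsB.mul_left _).tsum_le_tsum (fun j => ?_) hwB
    gcongr
    push_cast
    linarith [Nat.cast_nonneg (α := ℝ) j]
  have hl0 : 0 ≤ l2norm a := Real.sqrt_nonneg _
  have hl : l2norm a ^ 2 = ∑' j, a j ^ 2 := Real.sq_sqrt (tsum_nonneg fun j => sq_nonneg _)
  have h3 : (B : ℝ) ^ β * t ≤ M * l2norm a := by
    refine abs_le_of_sq_le_sq' ?_ (by positivity) |>.2
    rw [mul_pow, mul_pow, hl, ← pow_mul, mul_comm β 2]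
    calc (B : ℝ) ^ (2 * β) * t ^ 2 = ((B : ℝ) ^ (2 * β) * t) * t := by ring
      _ ≤ M ^ 2 * ∑' j, a j ^ 2 := mul_le_mul h2 h1 ht0 (sq_nonneg _)
  have hpow : (B : ℝ) ^ ((β : ℝ) / 2) = Real.sqrt ((B : ℝ) ^ β) := by
    rw [Real.sqrt_eq_rpow, ← Real.rpow_natCast, ← Real.rpow_mul hB0.le]
    congr 1
    ring
  rw [hpow, ← Real.sqrt_div' _ (by positivity)]
  refine Real.sqrt_le_sqrt ?_
  rw [le_div_iff₀ (by positivity), mul_comm]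
  exact h3

end Ellipsoid

lemma timeProd_univ (T : ℝ) {d : ℕ} (μ : Measure (Cube d)) [IsFiniteMeasure μ] :
    timeProd T μ Set.univ = ENNReal.ofReal (T * μ.real Set.univ) := by
  rw [timeProd, ← Set.univ_prod_univ, Measure.prod_prod, lebesgue_univ,
    ENNReal.ofReal_mul' measureReal_nonneg, measureReal_def,
    ENNReal.ofReal_toReal (measure_ne_top _ _)]

lemma lintegral_enorm_le_sqrt_mul {E : Type*} [MeasurableSpace E] {ν : Measure E} {g : E → ℝ}
    (hg : Measurable g) {V r : ℝ} (hV : 0 ≤ V) (hν : ν Set.univ = ENNReal.ofReal V)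
    (hr : eLpNorm g 2 ν ≤ ENNReal.ofReal r) :
    ∫⁻ p, ‖g p‖ₑ ∂ν ≤ ENNReal.ofReal (r * Real.sqrt V) := by
  have h := eLpNorm_le_eLpNorm_mul_rpow_measure_univ (p := 1) (q := 2) one_le_two
    hg.aestronglyMeasurable (μ := ν)
  rw [eLpNorm_one_eq_lintegral_enorm, hν] at h
  refine h.trans ?_
  rw [ENNReal.ofReal_mul' (Real.sqrt_nonneg _)]
  gcongr
  rw [Real.sqrt_eq_rpow, ENNReal.ofReal_rpow_of_nonneg hV (by norm_num)]
  norm_num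

/-! ### The optimal risk -/

section Bayes

variable {Ω S : Type*} [MeasurableSpace Ω] [MeasurableSpace S] {T : ℝ} [hT : Fact (0 < T)]
  {X : Time T → Ω → ℕ} {W : Ω → S} {u : ℕ}
  {Qp Qm : Measure Ω} [IsFiniteMeasure Qp] [IsFiniteMeasure Qm] {gp gm : Time T × S → ℝ}
  {r ε D : ℝ}

/-- Among the functions of the stopped observations, the sum of the log-odds `log r` of the labels
and of the log-likelihood ratio minimizes the logit risk. -/
lemma IsCox.logit_risk_le (hp : IsCox Qp X W gp) (hm : IsCox Qm X W gm) (hr : 0 < r)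
    (hc : Qp.map W = ENNReal.ofReal r • Qm.map W) (hε : 0 < ε) (hpI : ∀ q, gp q ∈ Set.Icc ε D)
    (hmI : ∀ q, gm q ∈ Set.Icc ε D) (hεD : ε ≤ D) {L : Ω → ℝ}
    (hL : ∀ ω, L ω = Real.log r + logLikelihood u (fun s => gp (s, W ω))
      (fun s => gm (s, W ω)) (fun t => X t ω)) {h : Ω → ℝ} (hh : Measurable[stoppedSigma X W u] h) :
    ∫⁻ ω, ENNReal.ofReal (logitLoss (-L ω)) ∂Qp + ∫⁻ ω, ENNReal.ofReal (logitLoss (L ω)) ∂Qm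
      ≤ ∫⁻ ω, ENNReal.ofReal (logitLoss (-h ω)) ∂Qp
        + ∫⁻ ω, ENNReal.ofReal (logitLoss (h ω)) ∂Qm := by
  have hle : stoppedSigma X W u ≤ ‹MeasurableSpace Ω› :=
    stoppedSigma_le hm.measurable_X hm.measurable_W
  have hLm : Measurable[stoppedSigma X W u] L := by
    have h1 := @measurable_logLikelihood Ω S _ T _ X W u (stoppedSigma X W u) hm.counting
      measurable_param_stoppedSigma
      (fun k hk t => measurableSet_le_stoppedSigma hm.counting hk t) gp gm hp.measurable_g
      hm.measurable_g
    have h2 : L = fun ω => Real.log r + logLikelihood u (fun s => gp (s, W ω))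
      (fun s => gm (s, W ω)) (fun t => X t ω) := funext hL
    rw [h2]
    exact h1.const_add _
  have key : ∀ {f : Ω → ℝ}, Measurable[stoppedSigma X W u] f →
      ∫⁻ ω, ENNReal.ofReal (logitLoss (-f ω)) ∂Qp + ∫⁻ ω, ENNReal.ofReal (logitLoss (f ω)) ∂Qm
        = ∫⁻ ω, ENNReal.ofReal (Real.exp (L ω) * logitLoss (-f ω) + logitLoss (f ω)) ∂Qm := by
    intro f hf
    have hlf : Measurable[stoppedSigma X W u] fun ω => ENNReal.ofReal (logitLoss (-f ω)) :=
      (measurable_logitLoss.comp hf.neg).ennreal_ofReal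
    have hlf' : Measurable fun ω => ENNReal.ofReal (logitLoss (f ω)) :=
      (measurable_logitLoss.comp (hf.mono hle le_rfl)).ennreal_ofReal
    rw [hp.lintegral_eq_stoppedLikelihood hm hc hε hpI hmI hεD ENNReal.ofReal_ne_top hlf,
      ← lintegral_const_mul' _ _ ENNReal.ofReal_ne_top, ← lintegral_add_right _ hlf']
    refine lintegral_congr fun ω => ?_
    rw [ENNReal.ofReal_add (mul_nonneg (Real.exp_pos _).le (logitLoss_nonneg _))
      (logitLoss_nonneg _), ENNReal.ofReal_mul (Real.exp_pos _).le, ← mul_assoc,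
      ← ENNReal.ofReal_mul hr.le, hL, Real.exp_add, Real.exp_log hr]
  rw [key hLm, key hh]
  exact lintegral_mono fun ω => ENNReal.ofReal_le_ofReal (logitLoss_log_odds_le _ _)

end Bayes

/-! ### The classification model as a pair of Cox processes -/

section Model

variable {Ω : Type*} [MeasurableSpace Ω] {P : Measure Ω} {T : ℝ} {d : ℕ}
  {X : Time T → Ω → ℕ} {Z : Time T → Ω → Cube d} {Y : Ω → ℝ} {lamP lamM : Time T × Cube d → ℝ}

/-- A process that is jointly measurable with respect to its own σ-algebra is a measurable function
of the time and of the whole path. -/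
lemma exists_measurable_evaluation {Ω : Type*} {T : ℝ} {d : ℕ} {Z : Time T → Ω → Cube d}
    (hZ : Measurable[MeasurableSpace.prod inferInstance (sigmaZ Z)]
      (fun q : Time T × Ω => Z q.1 q.2)) :
    ∃ ζ : Time T × (Time T → Cube d) → Cube d, Measurable ζ ∧
      ∀ s ω, Z s ω = ζ (s, fun t => Z t ω) := by
  have hcomap : MeasurableSpace.prod (inferInstance : MeasurableSpace (Time T)) (sigmaZ Z)
      = MeasurableSpace.comap (Prod.map id fun ω t => Z t ω) inferInstance := by
    have h := @MeasurableSpace.comap_prodMap (Time T) (Time T → Cube d) _ _ inferInstance inferInstance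
      id (fun (ω : Ω) t => Z t ω)
    rw [MeasurableSpace.comap_id] at h
    exact h.symm
  rw [hcomap] at hZ
  obtain ⟨ζ, hζ, h⟩ := hZ.exists_eq_measurable_comp
  exact ⟨ζ, hζ, fun s ω => congrFun h (s, ω)⟩

lemma measurable_intensity (hlamP : Measurable lamP) (hlamM : Measurable lamM) (y : ℝ) :
    Measurable (intensity lamP lamM y) := by
  unfold intensity
  split_ifs <;> assumption

lemma intensity_nonneg (hP : ∀ q, 0 ≤ lamP q) (hM : ∀ q, 0 ≤ lamM q) (y : ℝ)
    (q : Time T × Cube d) : 0 ≤ intensity lamP lamM y q := by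
  unfold intensity
  split_ifs
  · exact hP q
  · exact hM q

lemma IsCoxMixture.measurable_path (h : IsCoxMixture P X Z Y lamP lamM) :
    Measurable fun ω t => Z t ω :=
  measurable_pi_lambda _ h.measurable_Z

lemma IsCoxMixture.measurableSet_label (h : IsCoxMixture P X Z Y lamP lamM) (y : ℝ) :
    MeasurableSet {ω | Y ω = y} :=
  h.measurable_Y (measurableSet_singleton y)

/-- Given the label, the model is a Cox process whose parameter is the path of the covariable. -/
lemma IsCoxMixture.isCox [IsProbabilityMeasure P] (h : IsCoxMixture P X Z Y lamP lamM)
    (hlamP : Measurable lamP) (hlamM : Measurable lamM) (hP : ∀ q, 0 ≤ lamP q)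
    (hM : ∀ q, 0 ≤ lamM q) {ζ : Time T × (Time T → Cube d) → Cube d} (hζ : Measurable ζ)
    (hZζ : ∀ s ω, Z s ω = ζ (s, fun t => Z t ω)) (y : ℝ) :
    IsCox (P.restrict {ω | Y ω = y}) X (fun ω t => Z t ω)
      (fun q => intensity lamP lamM y (q.1, ζ q)) where
  measurable_X := h.measurable_X
  measurable_W := h.measurable_path
  counting := h.counting
  measurable_g := (measurable_intensity hlamP hlamM y).comp (measurable_fst.prodMk hζ)
  law := by
    intro N t ht k A hA
    have hX := h.measurable_X
    have hAW := h.measurable_path hA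
    set E : Set Ω := {ω | ∀ i : Fin N, X (t i.succ) ω = X (t i.castSucc) ω + k i} with hE
    have hEm : MeasurableSet E := by
      have : E = ⋂ i, {ω | X (t i.succ) ω = X (t i.castSucc) ω + k i} := by ext; simp [hE]
      rw [this]
      exact MeasurableSet.iInter fun i => measurableSet_eq_fun (hX _) ((hX _).add_const _)
    have hle : sigmaYZ Y Z ≤ ‹MeasurableSpace Ω› :=
      (h.measurable_Y.prodMk h.measurable_path).comap_le
    set C : Set Ω := ((fun ω t => Z t ω) ⁻¹' A) ∩ {ω | Y ω = y} with hC
    have hCm : MeasurableSet[sigmaYZ Y Z] C := by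
      refine ⟨{y} ×ˢ A, (measurableSet_singleton y).prod hA, ?_⟩
      ext ω
      simp [hC, and_comm]
    have hnn : ∀ (ω : Ω) (i : Fin N), 0 ≤ ∫ s in Set.Ioc (t i.castSucc) (t i.succ),
        intensity lamP lamM (Y ω) (s, Z s ω) ∂(lebesgue T) := fun ω i =>
      integral_nonneg fun s => intensity_nonneg hP hM _ _
    set p : Ω → ℝ := fun ω => ∏ i : Fin N,
        (Real.exp (-(∫ s in Set.Ioc (t i.castSucc) (t i.succ),
              intensity lamP lamM (Y ω) (s, Z s ω) ∂(lebesgue T)))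
          * (∫ s in Set.Ioc (t i.castSucc) (t i.succ),
              intensity lamP lamM (Y ω) (s, Z s ω) ∂(lebesgue T)) ^ (k i)
            / (Nat.factorial (k i) : ℝ)) with hp
    have hcond : P⟦E | sigmaYZ Y Z⟧ =ᵐ[P] p := h.cox N t ht k
    have hpnn : ∀ ω, 0 ≤ p ω := fun ω => Finset.prod_nonneg fun i _ => by
      have := hnn ω i
      positivity
    have hpint : Integrable p P := integrable_condExp.congr hcond
    have hset : P.real (E ∩ C) = ∫ ω in C, p ω ∂P := by
      rw [← setIntegral_congr_ae (hle _ hCm) (hcond.mono fun ω hω _ => hω),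
        setIntegral_condExp hle ((integrable_const (1 : ℝ)).indicator hEm) hCm,
        setIntegral_indicator hEm, setIntegral_const, smul_eq_mul, mul_one, Set.inter_comm]
    have hset2 : P (E ∩ C) = ∫⁻ ω in C, ENNReal.ofReal (p ω) ∂P := by
      rw [← ofReal_integral_eq_lintegral_ofReal hpint.integrableOn (ae_of_all _ hpnn), ← hset,
        measureReal_def, ENNReal.ofReal_toReal (measure_ne_top _ _)]
    rw [Measure.restrict_apply (hEm.inter hAW), Set.inter_assoc, ← hC, hset2,
      Measure.restrict_restrict hAW, ← hC]
    refine setLIntegral_congr_fun (hle _ hCm) fun ω hω => ?_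
    have hy : Y ω = y := hω.2
    simp only [hp]
    rw [ENNReal.ofReal_prod_of_nonneg fun i _ => by
      have := hnn ω i
      positivity]
    refine Finset.prod_congr rfl fun i _ => ?_
    simp only [poissonWeight, hy, ← hZζ]

lemma IsCoxMixture.map_path_restrict (h : IsCoxMixture P X Z Y lamP lamM) (y : ℝ) :
    (P.restrict {ω | Y ω = y}).map (fun ω t => Z t ω)
      = P {ω | Y ω = y} • P.map (fun ω t => Z t ω) := by
  ext A hA
  have hAW := h.measurable_path hA
  rw [Measure.map_apply h.measurable_path hA, Measure.restrict_apply hAW, Measure.smul_apply,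
    Measure.map_apply h.measurable_path hA, smul_eq_mul, mul_comm]
  exact h.indep.measure_inter_preimage_eq_mul A {y} hA (measurableSet_singleton y)

lemma IsCoxMixture.lintegral_label (h : IsCoxMixture P X Z Y lamP lamM)
    (F : ℝ → Ω → ENNReal) :
    ∫⁻ ω, F (Y ω) ω ∂P
      = ∫⁻ ω, F 1 ω ∂(P.restrict {ω | Y ω = 1}) + ∫⁻ ω, F (-1) ω ∂(P.restrict {ω | Y ω = -1}) := by
  have hcompl : {ω | Y ω = 1}ᶜ = {ω | Y ω = -1} := by
    ext ω
    simp only [Set.mem_compl_iff, Set.mem_ofPred_eq]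
    rcases h.label ω with hω | hω <;> rw [hω] <;> norm_num
  rw [← lintegral_add_compl _ (h.measurableSet_label 1), hcompl]
  congr 1
  · exact setLIntegral_congr_fun (h.measurableSet_label 1) fun ω hω => by
      rw [show Y ω = 1 from hω]
  · exact setLIntegral_congr_fun (h.measurableSet_label (-1)) fun ω hω => by
      rw [show Y ω = -1 from hω]

/-- The bound on the densities of the covariable turns integrals along its path into integrals
against the reference measure. -/
lemma HasBoundedDensities.lintegral_le {μ : Measure (Cube d)} [IsFiniteMeasure μ]
    [IsProbabilityMeasure P] {D : ℝ}
    (hdens : HasBoundedDensities P Z μ D) (hZm : ∀ t, Measurable (Z t))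
    (hZj : Measurable fun q : Time T × Ω => Z q.1 q.2)
    {G : Time T × Cube d → ENNReal} (hG : Measurable G) :
    ∫⁻ ω, ∫⁻ s, G (s, Z s ω) ∂(lebesgue T) ∂P ≤ ENNReal.ofReal D * ∫⁻ q, G q ∂(timeProd T μ) := by
  have hGZ : Measurable fun q : Ω × Time T => G (q.2, Z q.2 q.1) :=
    hG.comp (measurable_snd.prodMk (hZj.comp measurable_swap))
  rw [lintegral_lintegral_swap hGZ.aemeasurable, timeProd, lintegral_prod _ hG.aemeasurable,
    ← lintegral_const_mul' _ _ ENNReal.ofReal_ne_top]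
  refine lintegral_mono fun s => ?_
  obtain ⟨h, hh, hhD, hlaw⟩ := hdens s
  have hGs : Measurable fun z => G (s, z) := hG.comp measurable_prodMk_left
  simp only
  rw [← lintegral_map (f := fun z => G (s, z)) hGs (hZm s), hlaw,
    lintegral_withDensity_eq_lintegral_mul _ hh hGs,
    ← lintegral_const_mul' _ _ ENNReal.ofReal_ne_top]
  refine lintegral_mono_ae ?_
  filter_upwards [hhD] with z hz
  exact mul_le_mul_left hz _

variable [hT : Fact (0 < T)]

lemma IsCoxMixture.lintegral_jumps_le [IsProbabilityMeasure P]
    (h : IsCoxMixture P X Z Y lamP lamM)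
    (hlamP : Measurable lamP) (hlamM : Measurable lamM) {ε D : ℝ} (hε : 0 < ε)
    (hP : ∀ q, lamP q ∈ Set.Icc ε D) (hM : ∀ q, lamM q ∈ Set.Icc ε D)
    {G : Time T × Cube d → ENNReal} (hG : Measurable G) :
    ∫⁻ ω, ∑ k ∈ Finset.Icc 1 (X (endTime T) ω), G (jumpTime k (fun t => X t ω),
        Z (jumpTime k (fun t => X t ω)) ω) ∂P
      ≤ ENNReal.ofReal D * ∫⁻ ω, ∫⁻ s, G (s, Z s ω) ∂(lebesgue T) ∂P := by
  obtain ⟨ζ, hζ, hZζ⟩ := exists_measurable_evaluation h.jointly_measurable_Z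
  have hcox := h.isCox hlamP hlamM (fun q => hε.le.trans (hP q).1) (fun q => hε.le.trans (hM q).1)
    hζ hZζ
  have hI : ∀ y q, intensity lamP lamM y q ∈ Set.Icc ε D := fun y q => by
    unfold intensity
    split_ifs
    · exact hP q
    · exact hM q
  have hy : ∀ y, ∫⁻ ω, ∑ k ∈ Finset.Icc 1 (X (endTime T) ω), G (jumpTime k (fun t => X t ω),
        Z (jumpTime k (fun t => X t ω)) ω) ∂(P.restrict {ω | Y ω = y})
      ≤ ENNReal.ofReal D * ∫⁻ ω, ∫⁻ s, G (s, Z s ω) ∂(lebesgue T) ∂(P.restrict {ω | Y ω = y}) := by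
    intro y
    have hc := (hcox y).campbell hε (fun q => hI y _)
      (G := fun q => G (q.1, ζ q)) (hG.comp (measurable_fst.prodMk hζ))
    simp only [← hZζ] at hc
    rw [hc, ← lintegral_const_mul' _ _ ENNReal.ofReal_ne_top]
    refine lintegral_mono fun ω => ?_
    simp only
    rw [← lintegral_const_mul' _ _ ENNReal.ofReal_ne_top]
    refine lintegral_mono fun s => ?_
    exact mul_le_mul_left (ENNReal.ofReal_le_ofReal (hI y _).2) _
  rw [h.lintegral_label (fun _ ω => ∑ k ∈ Finset.Icc 1 (X (endTime T) ω),
      G (jumpTime k (fun t => X t ω), Z (jumpTime k (fun t => X t ω)) ω)),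
    h.lintegral_label (fun _ ω => ∫⁻ s, G (s, Z s ω) ∂(lebesgue T)), mul_add]
  exact add_le_add (hy 1) (hy (-1))

lemma measurable_stopped {Ω : Type*} [MeasurableSpace Ω] {X : Time T → Ω → ℕ}
    {Z : Time T → Ω → Cube d} {u : ℕ} (hX : ∀ ω, IsCountingPath fun t => X t ω)
    (hXm : ∀ k ≤ u, ∀ t, MeasurableSet {ω | k ≤ X t ω})
    (hW : Measurable fun ω t => Z t ω) {ζ : Time T × (Time T → Cube d) → Cube d}
    (hζ : Measurable ζ) (hZζ : ∀ s ω, Z s ω = ζ (s, fun t => Z t ω)) :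
    Measurable fun ω => stopped u (fun t => X t ω) (fun t => Z t ω) := by
  refine Measurable.prodMk (measurable_pi_lambda _ fun t => ?_) (measurable_pi_lambda _ fun t => ?_)
  · simp only [(hX _).apply_min_jumpTime]
    exact measurable_min_of_measurableSet_le fun k hk => hXm k hk t
  · have hJ := measurable_jumpTime hX (hXm u le_rfl)
    have h := hζ.comp ((measurable_const (a := t)).min hJ |>.prodMk hW)
    simp only [Function.comp_def, ← hZζ] at h
    exact h

/-- The distance between an element of the class `F_B` and the log-likelihood ratio is controlled
by the truncation errors of both coefficient functions, integrated against time and against the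
counting path. -/
lemma IsCountingPath.ofReal_abs_sub_le {x : Time T → ℕ} (hx : IsCountingPath x) (u B : ℕ)
    (z : Time T → Cube d) {lamP lamM : Time T × Cube d → ℝ} {φ : ℕ → Time T × Cube d → ℝ}
    (hφ : ∀ j, Integrable (fun s => φ j (s, z s)) (lebesgue T))
    (hlam : Integrable (fun s => lamM (s, z s) - lamP (s, z s)) (lebesgue T)) (a b : ℕ → ℝ)
    (c : ℝ) :
    ENNReal.ofReal |(∑ j ∈ Finset.range B, (a j * timeIntegral u (φ j) (stopped u x z)
        + b j * jumpIntegral u (φ j) (stopped u x z)) + c)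
        - (c + logLikelihood u (fun s => lamP (s, z s)) (fun s => lamM (s, z s)) x)|
      ≤ ∫⁻ s, ‖(lamM (s, z s) - lamP (s, z s))
            - ∑ j ∈ Finset.range B, a j * φ j (s, z s)‖ₑ ∂(lebesgue T)
        + ∑ k ∈ Finset.Icc 1 (x (endTime T)),
            ‖Real.log (lamP (jumpTime k x, z (jumpTime k x)) / lamM (jumpTime k x, z (jumpTime k x)))
              - ∑ j ∈ Finset.range B, b j * φ j (jumpTime k x, z (jumpTime k x))‖ₑ := by
  simp only [hx.timeIntegral_stopped, hx.jumpIntegral_stopped]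
  set τ := jumpTime u x
  set K := Finset.Icc 1 (min (x (endTime T)) u) with hK
  have hα : ∫ s in Set.Iic τ, ((lamM (s, z s) - lamP (s, z s))
      - ∑ j ∈ Finset.range B, a j * φ j (s, z s)) ∂(lebesgue T)
      = ∫ s in Set.Iic τ, (lamM (s, z s) - lamP (s, z s)) ∂(lebesgue T)
        - ∑ j ∈ Finset.range B, a j * ∫ s in Set.Iic τ, φ j (s, z s) ∂(lebesgue T) := by
    rw [integral_sub hlam.integrableOn
      (integrable_finsetSum _ fun j _ => ((hφ j).const_mul _).integrableOn),
      integral_finsetSum _ fun j _ => ((hφ j).const_mul _).integrableOn]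
    simp only [integral_const_mul]
  have hβ : ∑ k ∈ K, (Real.log (lamP (jumpTime k x, z (jumpTime k x))
        / lamM (jumpTime k x, z (jumpTime k x)))
      - ∑ j ∈ Finset.range B, b j * φ j (jumpTime k x, z (jumpTime k x)))
      = ∑ k ∈ K, Real.log (lamP (jumpTime k x, z (jumpTime k x))
          / lamM (jumpTime k x, z (jumpTime k x)))
        - ∑ j ∈ Finset.range B, b j * ∑ k ∈ K, φ j (jumpTime k x, z (jumpTime k x)) := by
    rw [Finset.sum_sub_distrib, Finset.sum_comm]
    simp only [Finset.mul_sum]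
  have hdiff : (∑ j ∈ Finset.range B, (a j * ∫ s in Set.Iic τ, φ j (s, z s) ∂(lebesgue T)
        + b j * ∑ k ∈ K, φ j (jumpTime k x, z (jumpTime k x))) + c)
        - (c + logLikelihood u (fun s => lamP (s, z s)) (fun s => lamM (s, z s)) x)
      = -(∫ s in Set.Iic τ, ((lamM (s, z s) - lamP (s, z s))
          - ∑ j ∈ Finset.range B, a j * φ j (s, z s)) ∂(lebesgue T)
        + ∑ k ∈ K, (Real.log (lamP (jumpTime k x, z (jumpTime k x))
            / lamM (jumpTime k x, z (jumpTime k x)))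
          - ∑ j ∈ Finset.range B, b j * φ j (jumpTime k x, z (jumpTime k x)))) := by
    rw [hα, hβ, Finset.sum_add_distrib, logLikelihood]
    ring
  rw [hdiff, abs_neg, ← Real.enorm_eq_ofReal_abs]
  refine (enorm_add_le _ _).trans (add_le_add ?_ ?_)
  · exact (enorm_integral_le_lintegral_enorm _).trans (setLIntegral_le_lintegral _ _)
  · refine (enorm_sum_le _ _).trans (Finset.sum_le_sum_of_subset ?_)
    exact Finset.Icc_subset_Icc_right (min_le_left _ _)

end Model

end CoxClassification

/-! ### Truncation of the log-likelihood ratio -/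

theorem proposition4
    {Ω : Type*} [MeasurableSpace Ω] (P : Measure Ω) [IsProbabilityMeasure P]
    (T : ℝ) [Fact (0 < T)] (d : ℕ) (u : ℕ) (hu : 0 < u)
    (X : Time T → Ω → ℕ) (Z : Time T → Ω → Cube d) (Y : Ω → ℝ)
    (lamP lamM : Time T × Cube d → ℝ) (hlamP : Measurable lamP) (hlamM : Measurable lamM)
    (hmodel : IsCoxMixture P X Z Y lamP lamM)
    (μ : Measure (Cube d)) [IsFiniteMeasure μ] (ε D : ℝ) (hε : 0 < ε) (hD : 0 < D)
    (hdens : HasBoundedDensities P Z μ D)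
    (hP : ∀ q, lamP q ∈ Set.Icc ε D) (hM : ∀ q, lamM q ∈ Set.Icc ε D)
    (φ : ℕ → Time T × Cube d → ℝ) (hφ : ∀ j, Measurable (φ j))
    (hbasis : IsOrthonormalBasis (timeProd T μ) φ)
    (β : ℕ) (hβ : 0 < β) (M : ℝ) (hMpos : 0 < M)
    (hWa : (fun q => lamM q - lamP q) ∈ ellipsoid (timeProd T μ) φ β M)
    (hWb : (fun q => Real.log (lamP q / lamM q)) ∈ ellipsoid (timeProd T μ) φ β M)
    (a b : ℕ → ℝ)
    (ha : HasExpansion (timeProd T μ) φ a (fun q => lamM q - lamP q))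
    (hb : HasExpansion (timeProd T μ) φ b (fun q => Real.log (lamP q / lamM q)))
    (B : ℕ)
    (hB : max (M ^ 2) |Real.log (P.real {ω | Y ω = 1} / P.real {ω | Y ω = -1})| ≤ (B : ℝ)) :
    (⨅ f ∈ classF u φ B, risk P u X Z Y f) ≤ optimalRisk P u X Z Y + ENNReal.ofReal
      (2 * D * Real.sqrt (T * μ.real Set.univ * M * l2norm a) / (B : ℝ) ^ ((β : ℝ) / 2)
        + 2 * D * (1 + D * Real.sqrt (T * μ.real Set.univ)) * Real.sqrt (M * l2norm b)
          / (B : ℝ) ^ ((β : ℝ) / 2)) := by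
  have hT : 0 < T := Fact.out
  have hMB : M ^ 2 ≤ B := (le_max_left _ _).trans hB
  have hB0 : 0 < B := by
    have : (0 : ℝ) < B := (pow_pos hMpos 2).trans_le hMB
    exact_mod_cast this
  -- The two label-conditional Cox processes.
  obtain ⟨ζ, hζ, hZζ⟩ := exists_measurable_evaluation hmodel.jointly_measurable_Z
  have hcox := hmodel.isCox hlamP hlamM (fun q => hε.le.trans (hP q).1)
    (fun q => hε.le.trans (hM q).1) hζ hZζ
  have hcp := hcox 1
  have hcm := hcox (-1)
  have hiP : intensity lamP lamM 1 = lamP := by simp [intensity]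
  have hiM : intensity lamP lamM (-1) = lamM := by
    have : (-1 : ℝ) ≠ 1 := by norm_num
    simp [intensity, this]
  rw [hiP] at hcp
  rw [hiM] at hcm
  have hZj : Measurable fun q : Time T × Ω => Z q.1 q.2 := by
    have h : Measurable fun q : Time T × Ω => ζ (q.1, fun t => Z t q.2) :=
      hζ.comp (measurable_fst.prodMk (hmodel.measurable_path.comp measurable_snd))
    simpa only [← hZζ] using h
  have hpp : 0 < P.real {ω | Y ω = 1} :=
    ENNReal.toReal_pos hmodel.label_pos.ne' (measure_ne_top _ _)
  have hpm : 0 < P.real {ω | Y ω = -1} :=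
    ENNReal.toReal_pos hmodel.label_neg.ne' (measure_ne_top _ _)
  set r : ℝ := P.real {ω | Y ω = 1} / P.real {ω | Y ω = -1} with hr_def
  have hr : 0 < r := div_pos hpp hpm
  have hc : (P.restrict {ω | Y ω = 1}).map (fun ω t => Z t ω)
      = ENNReal.ofReal r • (P.restrict {ω | Y ω = -1}).map (fun ω t => Z t ω) := by
    rw [hmodel.map_path_restrict, hmodel.map_path_restrict, smul_smul]
    congr 1
    rw [hr_def, ENNReal.ofReal_div_of_pos hpm, measureReal_def, measureReal_def,
      ENNReal.ofReal_toReal (measure_ne_top _ _), ENNReal.ofReal_toReal (measure_ne_top _ _),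
      ENNReal.div_mul_cancel hmodel.label_neg.ne' (measure_ne_top _ _)]
  have hεD : ε ≤ D := (hP (endTime T, fun _ => 0)).1.trans (hP (endTime T, fun _ => 0)).2
  -- The optimal classifier is the log-likelihood ratio.
  set L : Ω → ℝ := fun ω => Real.log r + logLikelihood u (fun s => lamP (s, Z s ω))
    (fun s => lamM (s, Z s ω)) (fun t => X t ω) with hL
  have hLm : Measurable L := by
    have h := measurable_logLikelihood (u := u) hmodel.counting hmodel.measurable_path
      (fun k _ t => measurableSet_le measurable_const (hmodel.measurable_X t))
      hcp.measurable_g hcm.measurable_g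
    simp only [← hZζ] at h
    exact h.const_add _
  have hopt : ∫⁻ ω, ENNReal.ofReal (logitLoss (-(Y ω) * L ω)) ∂P ≤ optimalRisk P u X Z Y := by
    refine le_iInf₂ fun f hf => ?_
    rw [risk, hmodel.lintegral_label fun y ω => ENNReal.ofReal (logitLoss (-y * L ω)),
      hmodel.lintegral_label fun y ω => ENNReal.ofReal (logitLoss (-y *
        f (stopped u (fun t => X t ω) fun t => Z t ω)))]
    simp only [neg_neg, one_mul, neg_one_mul]
    have hst := @measurable_stopped T d _ Ω (stoppedSigma X (fun ω t => Z t ω) u) X Z u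
      hmodel.counting (fun k hk t => measurableSet_le_stoppedSigma hmodel.counting hk t)
      measurable_param_stoppedSigma ζ hζ hZζ
    exact hcp.logit_risk_le hcm hr hc hε (fun q => hP _) (fun q => hM _) hεD
      (fun ω => by simp only [hL, ← hZζ]) (hf.comp hst)
  -- The candidate truncates both expansions.
  obtain ⟨a', ha', hsa, hMa⟩ := hWa
  obtain ⟨b', hb', hsb, hMb⟩ := hWb
  have hαm : Measurable fun q => lamM q - lamP q := hlamM.sub hlamP
  have hβm : Measurable fun q => Real.log (lamP q / lamM q) := (hlamP.div hlamM).log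
  obtain rfl : a' = a := HasExpansion.unique hbasis hφ hαm ha' ha
  obtain rfl : b' = b := HasExpansion.unique hbasis hφ hβm hb' hb
  set f : (Time T → ℕ) × (Time T → Cube d) → ℝ := fun p => ∑ j ∈ Finset.range B,
    (a' j * timeIntegral u (φ j) p + b' j * jumpIntegral u (φ j) p) + Real.log r with hf
  have hfB : f ∈ classF u φ B :=
    ⟨a', b', Real.log r, max_le (max_le (sum_abs_le_of_ellipsoid hsa hMa hMB)
      (sum_abs_le_of_ellipsoid hsb hMb hMB)) ((le_max_right _ _).trans hB), rfl⟩
  refine (iInf₂_le f hfB).trans ?_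
  -- The truncation errors.
  set α : Time T × Cube d → ℝ := fun q => (lamM q - lamP q) - ∑ j ∈ Finset.range B, a' j * φ j q
    with hα
  set γ : Time T × Cube d → ℝ := fun q => Real.log (lamP q / lamM q)
    - ∑ j ∈ Finset.range B, b' j * φ j q with hγ
  have hαmeas : Measurable α :=
    hαm.sub (Finset.measurable_sum _ fun j _ => (hφ j).const_mul _)
  have hγmeas : Measurable γ :=
    hβm.sub (Finset.measurable_sum _ fun j _ => (hφ j).const_mul _)
  set V := T * μ.real Set.univ with hV
  have hV0 : 0 ≤ V := mul_nonneg hT.le measureReal_nonneg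
  have hα1 : ∫⁻ q, ‖α q‖ₑ ∂(timeProd T μ)
      ≤ ENNReal.ofReal (Real.sqrt (M * l2norm a') / (B : ℝ) ^ ((β : ℝ) / 2) * Real.sqrt V) :=
    lintegral_enorm_le_sqrt_mul hαmeas hV0 (timeProd_univ T μ)
      ((ha.eLpNorm_truncation_le hbasis hφ hαm (summable_sq_of_ellipsoid hsa) B).trans
        (ENNReal.ofReal_le_ofReal (sqrt_tail_le_of_ellipsoid hMpos hsa hMa hB0)))
  have hγ1 : ∫⁻ q, ‖γ q‖ₑ ∂(timeProd T μ)
      ≤ ENNReal.ofReal (Real.sqrt (M * l2norm b') / (B : ℝ) ^ ((β : ℝ) / 2) * Real.sqrt V) :=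
    lintegral_enorm_le_sqrt_mul hγmeas hV0 (timeProd_univ T μ)
      ((hb.eLpNorm_truncation_le hbasis hφ hβm (summable_sq_of_ellipsoid hsb) B).trans
        (ENNReal.ofReal_le_ofReal (sqrt_tail_le_of_ellipsoid hMpos hsb hMb hB0)))
  have hν : IsFiniteMeasure (timeProd T μ) := ⟨by simp [timeProd_univ]⟩
  -- Almost surely, the functions of the dictionary are integrable along the covariable path.
  have hint : ∀ᵐ ω ∂P, ∀ j, Integrable (fun s => φ j (s, Z s ω)) (lebesgue T) := by
    rw [ae_all_iff]
    intro j
    have hfin : ∫⁻ q, ‖φ j q‖ₑ ∂(timeProd T μ) < ⊤ := by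
      obtain ⟨e, he⟩ := hbasis
      have hmem : MemLp (φ j) 2 (timeProd T μ) := (memLp_congr_ae (he j)).1 (Lp.memLp (e j))
      exact (hmem.integrable one_le_two).hasFiniteIntegral
    have hle := (hdens.lintegral_le hmodel.measurable_Z hZj (hφ j).enorm).trans_lt
      (ENNReal.mul_lt_top ENNReal.ofReal_lt_top hfin)
    have hjm : Measurable fun q : Ω × Time T => φ j (q.2, Z q.2 q.1) :=
      (hφ j).comp (measurable_snd.prodMk (hZj.comp measurable_swap))
    filter_upwards [ae_lt_top hjm.enorm.lintegral_prod_right' hle.ne] with ω hω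
    exact ⟨(hjm.comp measurable_prodMk_left).aestronglyMeasurable, hω⟩
  have herr : ∀ᵐ ω ∂P, ENNReal.ofReal (logitLoss (-(Y ω) *
        f (stopped u (fun t => X t ω) fun t => Z t ω)))
      ≤ ENNReal.ofReal (logitLoss (-(Y ω) * L ω)) + 2 * (∫⁻ s, ‖α (s, Z s ω)‖ₑ ∂(lebesgue T)
        + ∑ k ∈ Finset.Icc 1 (X (endTime T) ω), ‖γ (jumpTime k (fun t => X t ω),
            Z (jumpTime k (fun t => X t ω)) ω)‖ₑ) := by
    filter_upwards [hint] with ω hω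
    have hlam : Integrable (fun s => lamM (s, Z s ω) - lamP (s, Z s ω)) (lebesgue T) := by
      have h1 := integrable_section hcm.measurable_g hε (fun q => hM _) (fun t => Z t ω)
      have h2 := integrable_section hcp.measurable_g hε (fun q => hP _) (fun t => Z t ω)
      simp only [← hZζ] at h1 h2
      exact h1.sub h2
    have h1 := (hmodel.counting ω).ofReal_abs_sub_le u B (fun t => Z t ω) hω hlam a' b' (Real.log r)
    have habs : |-(Y ω) * f (stopped u (fun t => X t ω) fun t => Z t ω) - -(Y ω) * L ω|
        = |f (stopped u (fun t => X t ω) fun t => Z t ω) - L ω| := by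
      rw [← mul_sub, abs_mul, abs_neg]
      rcases hmodel.label ω with h | h <;> simp [h]
    have h2 := logitLoss_le_add (-(Y ω) * f (stopped u (fun t => X t ω) fun t => Z t ω))
      (-(Y ω) * L ω)
    rw [habs] at h2
    refine (ENNReal.ofReal_le_ofReal h2).trans ?_
    rw [ENNReal.ofReal_add (logitLoss_nonneg _) (by positivity), ENNReal.ofReal_mul zero_le_two,
      ENNReal.ofReal_ofNat]
    gcongr
  have hLloss : Measurable fun ω => ENNReal.ofReal (logitLoss (-(Y ω) * L ω)) :=
    (measurable_logitLoss.comp (hmodel.measurable_Y.neg.mul hLm)).ennreal_ofReal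
  have hαω : Measurable fun ω => ∫⁻ s, ‖α (s, Z s ω)‖ₑ ∂(lebesgue T) :=
    (hαmeas.enorm.comp (measurable_snd.prodMk
      (hZj.comp measurable_swap)) : Measurable fun q : Ω × Time T =>
        ‖α (q.2, Z q.2 q.1)‖ₑ).lintegral_prod_right'
  refine (lintegral_mono_ae herr).trans ?_
  rw [lintegral_add_left hLloss, lintegral_const_mul' _ _ ENNReal.ofNat_ne_top,
    lintegral_add_left hαω]
  refine add_le_add hopt ?_
  have h1 := (hdens.lintegral_le hmodel.measurable_Z hZj hαmeas.enorm).trans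
    (mul_le_mul_right hα1 _)
  have h2 := (hmodel.lintegral_jumps_le hlamP hlamM hε hP hM hγmeas.enorm).trans
    (mul_le_mul_right ((hdens.lintegral_le hmodel.measurable_Z hZj hγmeas.enorm).trans
      (mul_le_mul_right hγ1 _)) _)
  refine (mul_le_mul_right (add_le_add h1 h2) _).trans ?_
  rw [← ENNReal.ofReal_mul hD.le, ← ENNReal.ofReal_mul hD.le, ← ENNReal.ofReal_mul hD.le,
    ← ENNReal.ofReal_add (by positivity) (by positivity), ← ENNReal.ofReal_ofNat,
    ← ENNReal.ofReal_mul zero_le_two]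
  refine ENNReal.ofReal_le_ofReal ?_
  have hsqrt : Real.sqrt (V * M * l2norm a') = Real.sqrt V * Real.sqrt (M * l2norm a') := by
    rw [mul_assoc, Real.sqrt_mul hV0]
  have hextra : 0 ≤ 2 * D * (Real.sqrt (M * l2norm b') / (B : ℝ) ^ ((β : ℝ) / 2)) := by positivity
  rw [hsqrt]
  calc _ = 2 * D * (Real.sqrt V * Real.sqrt (M * l2norm a')) / (B : ℝ) ^ ((β : ℝ) / 2)
        + 2 * D * (D * Real.sqrt V) * Real.sqrt (M * l2norm b') / (B : ℝ) ^ ((β : ℝ) / 2) := by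
        ring
    _ ≤ 2 * D * (Real.sqrt V * Real.sqrt (M * l2norm a')) / (B : ℝ) ^ ((β : ℝ) / 2)
        + 2 * D * (D * Real.sqrt V) * Real.sqrt (M * l2norm b') / (B : ℝ) ^ ((β : ℝ) / 2)
        + 2 * D * (Real.sqrt (M * l2norm b') / (B : ℝ) ^ ((β : ℝ) / 2)) :=
        le_add_of_nonneg_right hextra
    _ = _ := by ring
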